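/- **Machine model.** An addition RAM is a finite sequence of instructions $I_0,\dots,I_{r-1}$ acting on an accumulator $A$, a buffer $B$, work registers $R[0],R[1],\dots$, input registers $I[0],I[1],\dots$ and an input size register $N$, all containing natural numbers. The instructions are $A\gets j$ (for a constant $j$), $B\gets A$, $R[A]\gets B$, $A\gets R[A]$, "if $A=0$ go to $\ell_0$, else go to $\ell_1$", $A\gets A+B$, $A\gets N$, $A\gets I[A]$, and "output $A$". Execution starts at $I_0$ with $A=B=0$ and stops when control reaches the end of the program; each executed instruction costs one unit of time. **Theorem (division in constant time).** There is an absolute constant $C$ such that for every integer $d\ge 1$ there are an addition RAM, consisting of a pre-computation program and a query program that share the work registers, and a constant $c=c(d)$, such that for every integer $N\ge 1$: 1. *Pre-computation.* Started on the single input $N$ with all work registers equal to $0$, the pre-computation program halts after at most $cN$ steps. 2. *Division.* For all integers $a,b$ with $0\le a<N^d$ and $0<b<N^d$, the query program, started on the work registers left by the pre-computation, with the $d$ base-$N$ digits of $a$ (least significant first) in $I[0],\dots,I[d-1]$ and those of $b$ in $I[d],\dots,I[2d-1]$, halts after at most $C\,d^4$ steps. Its output is the list of the $d$ base-$N$ digits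 of the quotient $\lfloor a/b\rfloor$, followed by the $d$ base-$N$ digits of the remainder $a \bmod b$ (least significant first in each case). Moreover, throughout both phases all registers contain integers at most $cN$, and hence only addresses at most $cN$ are used. -/

import Mathlib

namespace AddRAM

/-- Instructions of the random access machine with accumulator `A`, buffer `B`, work registers
`R[0], R[1], …`, input registers `I[0], I[1], …` and input size register `N`.
Addition is the only arithmetic operation. -/
inductive Instr where
  /-- `A ← j` -/
  | cst (j : ℕ)
  /-- `B ← A` -/
  | buffer
  /-- `R[A] ← B` -/
  | store
  /-- `A ← R[A]` -/
  | load
  /-- if `A = 0` then go to instruction `l₀`, else go to instruction `l₁` -/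
  | jzero (l₀ l₁ : ℕ)
  /-- `A ← A + B` -/
  | add
  /-- `A ← N` -/
  | getN
  /-- `A ← I[A]` -/
  | input
  /-- output the content of `A` -/
  | output

/-- A program is the sequence of its instructions, numbered from `0`. -/
abbrev Program := List Instr

/-- A configuration: the contents of `A` and `B`, the index `pc` of the current instruction,
the contents `mem j` of the work registers `R[j]`, and the list of the values output so far. -/
structure Config where
  A : ℕ
  B : ℕ
  pc : ℕ
  mem : ℕ → ℕ
  out : List ℕ

/-- The configuration in which a program starts on given contents of the work registers. -/
def Config.start (mem : ℕ → ℕ) : Config :=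
  { A := 0, B := 0, pc := 0, mem := mem, out := [] }

/-- The effect of one instruction, for the input size `N` and the input registers `I`. -/
def exec (N : ℕ) (I : ℕ → ℕ) (c : Config) : Instr → Config
  | .cst j => { c with A := j, pc := c.pc + 1 }
  | .buffer => { c with B := c.A, pc := c.pc + 1 }
  | .store => { c with mem := Function.update c.mem c.A c.B, pc := c.pc + 1 }
  | .load => { c with A := c.mem c.A, pc := c.pc + 1 }
  | .jzero l₀ l₁ => { c with pc := if c.A = 0 then l₀ else l₁ }
  | .add => { c with A := c.A + c.B, pc := c.pc + 1 }
  | .getN => { c with A := N, pc := c.pc + 1 }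
  | .input => { c with A := I c.A, pc := c.pc + 1 }
  | .output => { c with out := c.out ++ [c.A], pc := c.pc + 1 }

/-- A configuration is final if there is no instruction to execute: the control has
reached (or was sent beyond) the end of the program. -/
def IsFinal (P : Program) (c : Config) : Prop :=
  P.length ≤ c.pc

/-- One step of the computation; a final configuration is left unchanged. -/
def step (P : Program) (N : ℕ) (I : ℕ → ℕ) (c : Config) : Config :=
  match P[c.pc]? with
  | none => c
  | some ins => exec N I c ins

/-- All registers of the configuration contain integers at most `M`. -/
def Config.BoundedBy (M : ℕ) (c : Config) : Prop :=
  c.A ≤ M ∧ c.B ≤ M ∧ ∀ j, c.mem j ≤ M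

/-- Started in the configuration `c`, the program stops in the final configuration `c'` after at
most `T` instructions, each of unit cost, and at every moment of the computation all registers
contain integers at most `M`. As every address used is the content of `A`, this also bounds
all addresses by `M`. -/
def HaltsIn (P : Program) (N : ℕ) (I : ℕ → ℕ) (M T : ℕ) (c c' : Config) : Prop :=
  ∃ t ≤ T, (step P N I)^[t] c = c' ∧ IsFinal P c' ∧
    ∀ s ≤ t, ((step P N I)^[s] c).BoundedBy M

/-- A machine with a pre-computation phase and a query phase, sharing the work registers. -/
structure TwoPhaseRAM where
  pre : Program
  query : Program

/-- The `d` base-`N` digits of an integer `x < N ^ d`, least significant digit first. -/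
def digitList (N d x : ℕ) : List ℕ :=
  (List.range d).map fun i => x / N ^ i % N

/-- Input registers holding the `d` base-`N` digits of `a` in `I[0], …, I[d - 1]`, and those of `b`
in `I[d], …, I[2d - 1]`; the remaining ones contain `0`. -/
def pairInput (N d a b : ℕ) : ℕ → ℕ :=
  fun i => (digitList N d a ++ digitList N d b).getD i 0

end AddRAM

namespace AddRAM

/-! The query may only add and look up, and its length must not depend on `N`. Choose a base `K`
with `N < K ^ 5 ≤ 32 * N`. Tables indexed by five base-`K` digits then have `O(N)` entries, while a
number below `N ^ d` has at most `5 * d` digits in base `K`, so schoolbook arithmetic on digits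
costs a number of steps polynomial in `d` alone.

Division is long division in base `K`. Three leading digits `ρ` of the current remainder and two
leading digits `β` of the divisor form one index below `K ^ 5`, and a single look-up gives the floor
of `ρ / (β + 1)`. Since `K ≤ β`, this is the true quotient digit or one less (`estimate`), so
subtracting the estimated multiple and then trying to subtract the divisor once more yields the
digit (`wp_divStep`). Subtraction and comparison are not available; they are replaced by adding a
multiple of the complement of the divisor and inspecting the final carry (`wp_trySub`). The divisor
needs two digits, so both operands are first multiplied by `K`: the quotient is unchanged and the
remainder gets the factor `K`. Base `N` is converted to base `K` by Horner's rule, and back by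
repeated division by `N`.

The pre-computation finds `K` by counting to `N` and doubling `K` whenever the counter reaches `K ^
5` (`runs_findBase`). It then fills the tables in an order in which each entry arises from earlier
values by a bounded number of additions and equality tests.

The programs are written in a small structured language. In the query all repetitions over digit
positions are unrolled, so its length depends on `d` only; `K` occurs only as data in memory.
Weakest preconditions of loop-free commands are transferred to the machine by `wp.runs`; the real
loops, all in the pre-computation, are handled by `Runs.forLoop`. Cells hold values at most `V`, a
constant multiple of `N`, and addresses are `32 * i + idx`, which gives the bound on all registers.
-/

/-! ### Memory layout, structured language and compilation -/

/-- Classes of memory cells: look-up tables, digit arrays and scalars. -/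
inductive Cls where
  | tDiv | tMod | tShift | tMul | tCompl | tQuot
  | rem | dvs | compl | quo | tmp | base | acc | sav
  | wrk | car | mlt | mltK | flg | pre
  deriving DecidableEq

/-- The residue modulo `32` of the addresses of the cells of a class. -/
def Cls.idx : Cls → ℕ
  | tDiv => 0 | tMod => 1 | tShift => 2 | tMul => 3 | tCompl => 4 | tQuot => 5
  | rem => 6 | dvs => 7 | compl => 8 | quo => 9 | tmp => 10 | base => 11 | acc => 12 | sav => 13
  | wrk => 14 | car => 15 | mlt => 16 | mltK => 17 | flg => 18 | pre => 19

theorem Cls.idx_lt (t : Cls) : t.idx < 30 := by cases t <;> simp [Cls.idx]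

theorem Cls.idx_injective : Function.Injective Cls.idx := by
  intro a b h
  cases a <;> cases b <;> first | rfl | simp [Cls.idx] at h

/-- A memory cell, named by its class and its index in the class. -/
abbrev Cell := Cls × ℕ

/-- The address of the cell of class `t` and index `i`. -/
def addr (t : Cls) (i : ℕ) : ℕ := 32 * i + t.idx

/-- Class and index are the remainder and quotient of the address by `32`. The residues `30` and
`31` belong to no class and remain free for scratch values. -/
theorem addr_inj {t u : Cls} {i j : ℕ} : addr t i = addr u j ↔ t = u ∧ i = j := by
  have h1 := t.idx_lt
  have h2 := u.idx_lt
  constructor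
  · intro h
    unfold addr at h
    have h3 : t.idx = u.idx := by omega
    exact ⟨Cls.idx_injective h3, by omega⟩
  · rintro ⟨rfl, rfl⟩; rfl

/-- A structured programming language over the cells. -/
inductive Cmd where
  /-- `x ← j` -/
  | const (x : Cell) (j : ℕ)
  /-- `x ← N` -/
  | getN (x : Cell)
  /-- `x ← I[j]` -/
  | inp (x : Cell) (j : ℕ)
  /-- `x ← y + z` -/
  | add (x y z : Cell)
  /-- `x ← y + j` -/
  | addc (x y : Cell) (j : ℕ)
  /-- `x ← 1` if `y = z` and `x ← 0` otherwise -/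
  | eq (x y z : Cell)
  /-- `x ← t[y]` -/
  | look (x : Cell) (t : Cls) (y : Cell)
  /-- `t[y] ← x` -/
  | put (t : Cls) (y x : Cell)
  /-- output `x` -/
  | out (x : Cell)
  | skip
  | seq (c₁ c₂ : Cmd)
  /-- if `x ≠ 0` then `c₁` else `c₂` -/
  | ite (x : Cell) (c₁ c₂ : Cmd)
  /-- while `x = 0` do `c` -/
  | loop (x : Cell) (c : Cmd)

infixr:65 " ;; " => Cmd.seq

/-- `A ← x` -/
def ldI (x : Cell) : List Instr := [.cst (addr x.1 x.2), .load]

/-- `x ← A` -/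
def stI (x : Cell) : List Instr := [.buffer, .cst (addr x.1 x.2), .store]

/-- `A ← 32 * A + k` -/
def adrI (k : ℕ) : List Instr :=
  [.buffer, .add, .buffer, .add, .buffer, .add, .buffer, .add, .buffer, .add, .buffer, .cst k, .add]

/-- The instructions of a command that is compiled to code without jumps. -/
def Cmd.prim : Cmd → List Instr
  | const x j => .cst j :: stI x
  | getN x => .getN :: stI x
  | inp x j => [.cst j, .input] ++ stI x
  | add x y z => ldI y ++ [.buffer] ++ ldI z ++ [.add] ++ stI x
  | addc x y j => ldI y ++ [.buffer, .cst j, .add] ++ stI x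
  | eq x y z => ldI y ++ adrI 31 ++ [.buffer, .cst 30, .store] ++
      ldI z ++ adrI 31 ++ [.buffer, .cst 62, .store] ++
      [.cst 0, .buffer, .cst 30, .load, .store, .cst 1, .buffer, .cst 62, .load, .store,
        .cst 30, .load, .load] ++ stI x
  | look x t y => ldI y ++ adrI t.idx ++ [.load] ++ stI x
  | put t y x => ldI y ++ adrI t.idx ++ [.buffer, .cst 30, .store] ++ ldI x ++
      [.buffer, .cst 30, .load, .store]
  | out x => ldI x ++ [.output]
  | _ => []

/-- The number of instructions of the compiled command. -/
def Cmd.size : Cmd → ℕ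
  | seq c₁ c₂ => c₁.size + c₂.size
  | ite _ c₁ c₂ => c₁.size + c₂.size + 4
  | loop _ c => c.size + 4
  | c => c.prim.length

/-- The code of a command, to be placed at instruction number `o`. -/
def Cmd.compile : Cmd → ℕ → List Instr
  | seq c₁ c₂, o => c₁.compile o ++ c₂.compile (o + c₁.size)
  | ite x c₁ c₂, o => ldI x ++ [.jzero (o + c₁.size + 4) (o + 3)] ++ c₁.compile (o + 3) ++
      [.jzero (o + c₁.size + c₂.size + 4) (o + c₁.size + c₂.size + 4)] ++
      c₂.compile (o + c₁.size + 4)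
  | loop x c, o => ldI x ++ [.jzero (o + 3) (o + c.size + 4)] ++ c.compile (o + 3) ++ [.jzero o o]
  | c, _ => c.prim

/-- The length of the code does not depend on where it is placed, which is why the absolute jump
targets can be computed from `size`. -/
theorem Cmd.length_compile (c : Cmd) : ∀ o, (c.compile o).length = c.size := by
  induction c <;> intro o <;> simp_all [Cmd.compile, Cmd.size, ldI]; omega

/-- A bound for the constants and the cell indices of a command. -/
def Cmd.bound : Cmd → ℕ
  | const x j => x.2 + j
  | getN x => x.2
  | inp x j => x.2 + j
  | add x y z => x.2 + y.2 + z.2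
  | addc x y j => x.2 + y.2 + j
  | eq x y z => x.2 + y.2 + z.2 + 2
  | look x _ y => x.2 + y.2
  | put _ y x => x.2 + y.2
  | out x => x.2
  | skip => 0
  | seq c₁ c₂ => c₁.bound + c₂.bound
  | ite x c₁ c₂ => x.2 + c₁.bound + c₂.bound
  | loop x c => x.2 + c.bound

/-! ### States and their representation by configurations -/

/-- The states of the structured language: contents of the cells and output. -/
structure St where
  σ : Cls → ℕ → ℕ
  out : List ℕ

/-- Assignment of a value to a cell. -/
def St.set (s : St) (x : Cell) (v : ℕ) : St :=
  { s with σ := Function.update s.σ x.1 (Function.update (s.σ x.1) x.2 v) }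

@[simp] theorem St.out_set (s : St) (x : Cell) (v : ℕ) : (s.set x v).out = s.out := rfl

@[simp] theorem St.set_same (s : St) (t : Cls) (i v : ℕ) :
    (s.set (t, i) v).σ t = Function.update (s.σ t) i v := by
  simp [St.set]

@[simp] theorem St.set_ne (s : St) {t u : Cls} (i v : ℕ) (h : u ≠ t) :
    (s.set (t, i) v).σ u = s.σ u := by
  simp [St.set, h]

/-- The configuration `c` of the machine represents the state `s`. -/
structure Rep (V : ℕ) (c : Config) (s : St) : Prop where
  bounded : c.BoundedBy (32 * V + 32)
  out_eq : c.out = s.out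
  mem_eq : ∀ t i, c.mem (addr t i) = s.σ t i
  le : ∀ t i, s.σ t i ≤ V

/-- The instructions `l` stand in the program `P` from number `o` on. -/
def CodeAt (P : Program) (o : ℕ) (l : List Instr) : Prop :=
  ∃ p q, P = p ++ l ++ q ∧ p.length = o

theorem CodeAt.left {P : Program} {o : ℕ} {l₁ l₂ : List Instr} (h : CodeAt P o (l₁ ++ l₂)) :
    CodeAt P o l₁ := by
  obtain ⟨p, q, rfl, h⟩ := h
  exact ⟨p, l₂ ++ q, by simp, h⟩

theorem CodeAt.right {P : Program} {o : ℕ} {l₁ l₂ : List Instr} (h : CodeAt P o (l₁ ++ l₂)) :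
    CodeAt P (o + l₁.length) l₂ := by
  obtain ⟨p, q, rfl, h⟩ := h
  exact ⟨p ++ l₁, q, by simp, by simp [h]⟩

theorem CodeAt.get {P : Program} {o : ℕ} {i : Instr} {l : List Instr} (h : CodeAt P o (i :: l)) :
    P[o]? = some i := by
  obtain ⟨p, q, rfl, rfl⟩ := h
  simp

theorem CodeAt.tail {P : Program} {o : ℕ} {i : Instr} {l : List Instr} (h : CodeAt P o (i :: l)) :
    CodeAt P (o + 1) l :=
  CodeAt.right (l₁ := [i]) h

/-! ### Rules for running compiled commands -/

section Machine

variable (V N : ℕ) (I : ℕ → ℕ)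

/-- From the configuration `c` the program `P` arrives after at most `T` steps in a configuration
with `Q`, all registers being bounded on the way. -/
def Reach (P : Program) (T : ℕ) (c : Config) (Q : Config → Prop) : Prop :=
  ∃ t ≤ T, Q ((step P N I)^[t] c) ∧
    ∀ k ≤ t, ((step P N I)^[k] c).BoundedBy (32 * V + 32)

variable {V N I}

theorem Reach.refl {P : Program} {c : Config} {Q : Config → Prop}
    (hb : c.BoundedBy (32 * V + 32)) (hQ : Q c) : Reach V N I P 0 c Q :=
  ⟨0, le_rfl, hQ, fun k hk => by obtain rfl : k = 0 := by omega
                                 exact hb⟩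

theorem Reach.trans {P : Program} {T₁ T₂ : ℕ} {c : Config} {Q R : Config → Prop}
    (h₁ : Reach V N I P T₁ c R) (h₂ : ∀ c', R c' → Reach V N I P T₂ c' Q) :
    Reach V N I P (T₁ + T₂) c Q := by
  obtain ⟨t₁, ht₁, hR, hb₁⟩ := h₁
  obtain ⟨t₂, ht₂, hQ, hb₂⟩ := h₂ _ hR
  refine ⟨t₂ + t₁, by omega, by rwa [Function.iterate_add_apply], fun k hk => ?_⟩
  by_cases h : k ≤ t₁
  · exact hb₁ k h
  · obtain ⟨j, rfl⟩ : ∃ j, k = j + t₁ := ⟨k - t₁, by omega⟩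
    rw [Function.iterate_add_apply]
    exact hb₂ j (by omega)

theorem Reach.mono {P : Program} {T T' : ℕ} {c : Config} {Q R : Config → Prop}
    (h : Reach V N I P T c R) (hT : T ≤ T') (hQ : ∀ c', R c' → Q c') : Reach V N I P T' c Q := by
  obtain ⟨t, ht, hR, hb⟩ := h
  exact ⟨t, ht.trans hT, hQ _ hR, hb⟩

theorem Reach.step {P : Program} {T : ℕ} {c : Config} {i : Instr} {Q : Config → Prop}
    (hi : P[c.pc]? = some i) (hb : c.BoundedBy (32 * V + 32))
    (h : Reach V N I P T (exec N I c i) Q) : Reach V N I P (T + 1) c Q := by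
  obtain ⟨t, ht, hQ, hb'⟩ := h
  have hs : AddRAM.step P N I c = exec N I c i := by simp [AddRAM.step, hi]
  refine ⟨t + 1, by omega, by rwa [Function.iterate_succ_apply, hs], fun k hk => ?_⟩
  cases k with
  | zero => exact hb
  | succ k =>
    rw [Function.iterate_succ_apply, hs]
    exact hb' k (by omega)

/-- Instructions without jumps. -/
def Instr.Straight : Instr → Prop
  | .jzero _ _ => False
  | _ => True

/-- Symbolic execution of a list of instructions without jumps. -/
def Chain (V N : ℕ) (I : ℕ → ℕ) : List Instr → Config → (Config → Prop) → Prop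
  | [], c, Q => c.BoundedBy (32 * V + 32) ∧ Q c
  | i :: l, c, Q => c.BoundedBy (32 * V + 32) ∧ i.Straight ∧ Chain V N I l (exec N I c i) Q

theorem exec_pc {c : Config} {i : Instr} (h : i.Straight) : (exec N I c i).pc = c.pc + 1 := by
  cases i <;> first | rfl | exact h.elim

theorem Chain.reach {P : Program} {l : List Instr} : ∀ {c : Config} {Q : Config → Prop},
    CodeAt P c.pc l → Chain V N I l c Q →
    Reach V N I P l.length c fun c' => c'.pc = c.pc + l.length ∧ Q c' := by
  induction l with
  | nil => exact fun _ h => Reach.refl h.1 ⟨rfl, h.2⟩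
  | cons i l ih =>
    intro c Q hc h
    refine Reach.step hc.get h.1 ((ih ?_ h.2.2).mono le_rfl ?_)
    · rw [exec_pc h.2.1]; exact hc.tail
    · rw [exec_pc h.2.1]
      rintro c' ⟨h1, h2⟩
      exact ⟨by simp only [List.length_cons]; omega, h2⟩

variable (V N I) in
/-- In any program, the code of `c` started in the state `s` runs through in at most `T` steps,
all registers being bounded on the way, and leads to a state with `Q`. -/
def Runs (c : Cmd) (T : ℕ) (s : St) (Q : St → Prop) : Prop :=
  ∀ (P : Program) (g : Config), CodeAt P g.pc (c.compile g.pc) → Rep V g s →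
    Reach V N I P T g fun g' => g'.pc = g.pc + c.size ∧ ∃ s', Rep V g' s' ∧ Q s'

theorem Runs.mono {c : Cmd} {T T' : ℕ} {s : St} {Q R : St → Prop} (h : Runs V N I c T s R)
    (hT : T ≤ T') (hQ : ∀ s', R s' → Q s') : Runs V N I c T' s Q :=
  fun P g hc hr => (h P g hc hr).mono hT fun _ ⟨h1, s', h2, h3⟩ => ⟨h1, s', h2, hQ s' h3⟩

theorem Runs.seq {c₁ c₂ : Cmd} {T₁ T₂ : ℕ} {s : St} {Q R : St → Prop}
    (h₁ : Runs V N I c₁ T₁ s R) (h₂ : ∀ s', R s' → Runs V N I c₂ T₂ s' Q) :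
    Runs V N I (c₁ ;; c₂) (T₁ + T₂) s Q := by
  intro P g hc hr
  have hl := Cmd.length_compile c₁ g.pc
  refine (h₁ P g hc.left hr).trans ?_
  rintro g' ⟨hpc, s', hr', hR⟩
  refine (h₂ s' hR P g' ?_ hr').mono le_rfl ?_
  · rw [hpc]
    simpa [hl] using CodeAt.right hc
  · rintro g'' ⟨h1, h2⟩
    exact ⟨by rw [h1, hpc, Cmd.size]; omega, h2⟩

theorem Rep.set_AB {g : Config} {s : St} (h : Rep V g s) {a b pc : ℕ} (ha : a ≤ 32 * V + 32)
    (hb : b ≤ 32 * V + 32) : Rep V { g with A := a, B := b, pc := pc } s :=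
  ⟨⟨ha, hb, h.bounded.2.2⟩, h.out_eq, h.mem_eq, h.le⟩

theorem addr_le {V i : ℕ} (t : Cls) (h : i ≤ V) : addr t i ≤ 32 * V + 32 := by
  have := t.idx_lt
  unfold addr
  omega

/-- Loading the condition of a branching instruction. -/
theorem Rep.branch {P : Program} {g : Config} {s : St} {x : Cell} {l₀ l₁ T : ℕ} {l : List Instr}
    {Q : Config → Prop} (hr : Rep V g s) (hx : x.2 ≤ V)
    (hc : CodeAt P g.pc (ldI x ++ [.jzero l₀ l₁] ++ l))
    (h : ∀ g' : Config, g'.pc = (if s.σ x.1 x.2 = 0 then l₀ else l₁) → Rep V g' s →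
      Reach V N I P T g' Q) : Reach V N I P (T + 3) g Q := by
  have hb := hr.bounded
  have h1 : addr x.1 x.2 ≤ 32 * V + 32 := addr_le _ hx
  have h2 := hr.le x.1 x.2
  simp only [ldI, List.cons_append, List.nil_append] at hc
  refine Reach.step hc.get hb (Reach.step hc.tail.get ?_ (Reach.step hc.tail.tail.get ?_ ?_))
  · exact ⟨h1, hb.2⟩
  · refine ⟨?_, hb.2⟩
    simp only [exec, hr.mem_eq]
    omega
  · apply h
    · simp [exec, hr.mem_eq]
    · refine Rep.set_AB hr ?_ hb.2.1
      simp only [exec, hr.mem_eq]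
      omega

theorem Runs.ite {x : Cell} {c₁ c₂ : Cmd} {T : ℕ} {s : St} {Q : St → Prop} (hx : x.2 ≤ V)
    (h₁ : s.σ x.1 x.2 ≠ 0 → Runs V N I c₁ T s Q) (h₂ : s.σ x.1 x.2 = 0 → Runs V N I c₂ T s Q) :
    Runs V N I (.ite x c₁ c₂) (T + 4) s Q := by
  intro P g hc hr
  have hl := Cmd.length_compile c₁ (g.pc + 3)
  rw [show T + 4 = (T + 1) + 3 by omega]
  simp only [Cmd.compile, List.append_assoc] at hc
  rw [← List.append_assoc] at hc
  refine hr.branch hx hc fun g' hg hr' => ?_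
  have hc1 := hc.right
  have hc2 := hc1.right.tail
  simp only [ldI, hl, List.length_append, List.length_cons, List.length_nil] at hc1 hc2
  split_ifs at hg with h0
  · refine (h₂ h0 P g' ?_ hr').mono (by omega) fun g'' h => ⟨?_, h.2⟩
    · rw [hg]
      convert hc2 using 1
      · omega
      · rfl
    · rw [h.1, hg, Cmd.size]
      omega
  · refine (h₁ h0 P g' ?_ hr').trans ?_
    · rw [hg]
      exact hc1.left
    · rintro g'' ⟨hpc, s', hr'', hQ⟩
      refine Reach.step (i := .jzero (g.pc + c₁.size + c₂.size + 4) (g.pc + c₁.size + c₂.size + 4))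
        ?_ hr''.bounded (Reach.refl ?_ ⟨?_, s', ?_, hQ⟩)
      · rw [hpc, hg]
        have := hc1.right.get
        rwa [hl] at this
      · exact hr''.bounded
      · simp only [exec, ite_self, Cmd.size]
        omega
      · exact Rep.set_AB hr'' hr''.bounded.1 hr''.bounded.2.1

theorem Runs.loop_done {x : Cell} {c : Cmd} {s : St} {Q : St → Prop} (hx : x.2 ≤ V)
    (h : s.σ x.1 x.2 ≠ 0) (hQ : Q s) : Runs V N I (.loop x c) 3 s Q := by
  intro P g hc hr
  simp only [Cmd.compile, List.append_assoc] at hc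
  rw [← List.append_assoc] at hc
  refine Rep.branch (T := 0) hr hx hc fun g' hg hr' => ?_
  rw [if_neg h] at hg
  exact Reach.refl hr'.bounded ⟨by rw [hg, Cmd.size]; omega, s, hr', hQ⟩

/-- The postcondition of the body is again a `Runs` statement about the same loop, so a loop is
treated by induction on the number of remaining rounds. -/
theorem Runs.loop_step {x : Cell} {c : Cmd} {T T' : ℕ} {s : St} {Q : St → Prop} (hx : x.2 ≤ V)
    (h : s.σ x.1 x.2 = 0) (hc : Runs V N I c T s fun s' => Runs V N I (.loop x c) T' s' Q) :
    Runs V N I (.loop x c) (T + T' + 4) s Q := by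
  intro P g hg hr
  have hl := Cmd.length_compile c (g.pc + 3)
  have hg0 := hg
  simp only [Cmd.compile, List.append_assoc] at hg
  rw [← List.append_assoc] at hg
  rw [show T + T' + 4 = (T + (T' + 1)) + 3 by omega]
  refine hr.branch hx hg fun g' hpc hr' => ?_
  rw [if_pos h] at hpc
  have hg1 := hg.right
  simp only [ldI, List.length_append, List.length_cons, List.length_nil] at hg1
  refine (hc P g' ?_ hr').trans ?_
  · rw [hpc]
    exact hg1.left
  · rintro g'' ⟨hpc'', s', hr'', hs'⟩
    refine Reach.step (i := .jzero g.pc g.pc) ?_ hr''.bounded ?_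
    · rw [hpc'', hpc]
      have := hg1.right.get
      rwa [hl] at this
    · refine (hs' P (exec N I g'' (.jzero g.pc g.pc)) ?_ ?_).mono le_rfl ?_
      · simpa [exec] using hg0
      · exact Rep.set_AB hr'' hr''.bounded.1 hr''.bounded.2.1
      · simp [exec]

end Machine

/-! ### Primitive commands and weakest preconditions -/

section Primitive

variable {V N : ℕ} {I : ℕ → ℕ}

theorem Chain.append {l₁ l₂ : List Instr} : ∀ {g : Config} {Q : Config → Prop},
    Chain V N I l₁ g (fun g' => Chain V N I l₂ g' Q) → Chain V N I (l₁ ++ l₂) g Q := by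
  induction l₁ with
  | nil => exact fun h => h.2
  | cons i l₁ ih => exact fun h => ⟨h.1, h.2.1, ih h.2.2⟩

theorem chain_ldI {a b pc : ℕ} {m : ℕ → ℕ} {o : List ℕ} {x : Cell} {Q : Config → Prop}
    (ha : a ≤ 32 * V + 32) (hb : b ≤ 32 * V + 32) (hm : ∀ j, m j ≤ 32 * V + 32) (hx : x.2 ≤ V)
    (h : ∀ pc, Q ⟨m (addr x.1 x.2), b, pc, m, o⟩) : Chain V N I (ldI x) ⟨a, b, pc, m, o⟩ Q := by
  simp only [ldI, Chain, exec, Config.BoundedBy, Instr.Straight]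
  exact ⟨⟨ha, hb, hm⟩, trivial, ⟨addr_le _ hx, hb, hm⟩, trivial, ⟨hm _, hb, hm⟩, h _⟩

theorem update_le {M : ℕ} {m : ℕ → ℕ} (hm : ∀ j, m j ≤ M) {p v : ℕ} (hv : v ≤ M) (j : ℕ) :
    Function.update m p v j ≤ M := by
  rw [Function.update_apply]
  split_ifs
  exacts [hv, hm j]

theorem chain_stI {a b pc : ℕ} {m : ℕ → ℕ} {o : List ℕ} {x : Cell} {Q : Config → Prop}
    (ha : a ≤ 32 * V + 32) (hb : b ≤ 32 * V + 32) (hm : ∀ j, m j ≤ 32 * V + 32) (hx : x.2 ≤ V)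
    (h : ∀ pc, Q ⟨addr x.1 x.2, a, pc, Function.update m (addr x.1 x.2) a, o⟩) :
    Chain V N I (stI x) ⟨a, b, pc, m, o⟩ Q := by
  simp only [stI, Chain, exec, Config.BoundedBy, Instr.Straight]
  exact ⟨⟨ha, hb, hm⟩, trivial, ⟨ha, ha, hm⟩, trivial, ⟨addr_le _ hx, ha, hm⟩, trivial,
    ⟨addr_le _ hx, ha, update_le hm ha⟩, h _⟩

theorem chain_adrI {a b pc k : ℕ} {m : ℕ → ℕ} {o : List ℕ} {Q : Config → Prop}
    (ha : a ≤ V) (hb : b ≤ 32 * V + 32) (hm : ∀ j, m j ≤ 32 * V + 32) (hk : k < 32)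
    (h : ∀ pc, Q ⟨32 * a + k, 32 * a, pc, m, o⟩) :
    Chain V N I (adrI k) ⟨a, b, pc, m, o⟩ Q := by
  simp only [adrI, Chain, exec, Config.BoundedBy, Instr.Straight, true_and]
  simp only [hm, implies_true, and_true]
  refine ⟨by omega, by omega, by omega, by omega, by omega, by omega, by omega, by omega,
    by omega, by omega, by omega, by omega, by omega, by omega, ?_⟩
  convert h (pc + 13) using 2 <;> ring

/-- `R[p] ← A` for a fixed address `p`. -/
theorem chain_save {a b pc p : ℕ} {m : ℕ → ℕ} {o : List ℕ} {Q : Config → Prop}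
    (ha : a ≤ 32 * V + 32) (hb : b ≤ 32 * V + 32) (hm : ∀ j, m j ≤ 32 * V + 32)
    (hp : p ≤ 32 * V + 32)
    (h : ∀ pc, Q ⟨p, a, pc, Function.update m p a, o⟩) :
    Chain V N I [.buffer, .cst p, .store] ⟨a, b, pc, m, o⟩ Q := by
  simp only [Chain, exec, Config.BoundedBy, Instr.Straight]
  exact ⟨⟨ha, hb, hm⟩, trivial, ⟨ha, ha, hm⟩, trivial, ⟨hp, ha, hm⟩, trivial,
    ⟨hp, ha, update_le hm ha⟩, h _⟩

theorem runs_prim {c : Cmd} {s : St} {Q : St → Prop} (hc : ∀ o, c.compile o = c.prim)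
    (h : ∀ g, Rep V g s → Chain V N I c.prim g fun g' => ∃ s', Rep V g' s' ∧ Q s') :
    Runs V N I c c.prim.length s Q := by
  intro P g hP hr
  rw [hc] at hP
  have hl := Cmd.length_compile c 0
  rw [hc] at hl
  rw [← hl]
  exact (h g hr).reach hP

theorem Rep.set {g : Config} {s : St} (hr : Rep V g s) {x : Cell} {v a b pc : ℕ} (hv : v ≤ V)
    (ha : a ≤ 32 * V + 32) (hb : b ≤ 32 * V + 32) :
    Rep V ⟨a, b, pc, Function.update g.mem (addr x.1 x.2) v, g.out⟩ (s.set x v) := by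
  refine ⟨⟨ha, hb, update_le hr.bounded.2.2 (by omega)⟩, hr.out_eq, fun t i => ?_, fun t i => ?_⟩
  · simp only [St.set, Function.update_apply, addr_inj]
    by_cases h : t = x.1
    · subst h; simp [Function.update_apply, hr.mem_eq]
    · simp [h, hr.mem_eq]
  · simp only [St.set, Function.update_apply]
    split_ifs with h
    · rw [Function.update_apply]
      split_ifs
      exacts [hv, hr.le _ _]
    · exact hr.le _ _

/-- Assignments to cells of the two residue classes used for intermediate results. -/
theorem Rep.hidden {g : Config} {s : St} (hr : Rep V g s) {p v : ℕ} (hv : v ≤ 32 * V + 32)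
    (hp : 30 ≤ p % 32) : Rep V { g with mem := Function.update g.mem p v } s := by
  refine ⟨⟨hr.bounded.1, hr.bounded.2.1, update_le hr.bounded.2.2 hv⟩, hr.out_eq, fun t i => ?_,
    hr.le⟩
  have ht := t.idx_lt
  have : addr t i ≠ p := by unfold addr; omega
  simp [this, hr.mem_eq]

/-- The weakest precondition of a command without loops. -/
def wp (V N : ℕ) (I : ℕ → ℕ) : Cmd → (St → Prop) → St → Prop
  | .const x j, Q, s => Q (s.set x j)
  | .getN x, Q, s => Q (s.set x N)
  | .inp x j, Q, s => Q (s.set x (I j))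
  | .add x y z, Q, s => s.σ y.1 y.2 + s.σ z.1 z.2 ≤ V ∧ Q (s.set x (s.σ y.1 y.2 + s.σ z.1 z.2))
  | .addc x y j, Q, s => s.σ y.1 y.2 + j ≤ V ∧ Q (s.set x (s.σ y.1 y.2 + j))
  | .eq x y z, Q, s => Q (s.set x (if s.σ y.1 y.2 = s.σ z.1 z.2 then 1 else 0))
  | .look x t y, Q, s => Q (s.set x (s.σ t (s.σ y.1 y.2)))
  | .put t y x, Q, s => Q (s.set (t, s.σ y.1 y.2) (s.σ x.1 x.2))
  | .out x, Q, s => Q { s with out := s.out ++ [s.σ x.1 x.2] }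
  | .skip, Q, s => Q s
  | .seq c₁ c₂, Q, s => wp V N I c₁ (wp V N I c₂ Q) s
  | .ite x c₁ c₂, Q, s =>
      (s.σ x.1 x.2 ≠ 0 → wp V N I c₁ Q s) ∧ (s.σ x.1 x.2 = 0 → wp V N I c₂ Q s)
  | .loop _ _, _, _ => False

theorem wp_mono {c : Cmd} : ∀ {Q R : St → Prop} {s : St}, wp V N I c R s →
    (∀ s', R s' → Q s') → wp V N I c Q s := by
  induction c with
  | seq c₁ c₂ ih₁ ih₂ => exact fun h hQ => ih₁ h fun s' h' => ih₂ h' hQ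
  | ite x c₁ c₂ ih₁ ih₂ => exact fun h hQ => ⟨fun hx => ih₁ (h.1 hx) hQ, fun hx => ih₂ (h.2 hx) hQ⟩
  | loop => exact fun h => h.elim
  | add | addc => exact fun h hQ => ⟨h.1, hQ _ h.2⟩
  | _ => exact fun h hQ => hQ _ h

theorem wp_seq {c₁ c₂ : Cmd} {Q R : St → Prop} {s : St} (h₁ : wp V N I c₁ R s)
    (h₂ : ∀ s', R s' → wp V N I c₂ Q s') : wp V N I (c₁ ;; c₂) Q s := by
  change wp V N I c₁ (wp V N I c₂ Q) s
  exact wp_mono h₁ h₂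

theorem wp_cons {c₁ c₂ : Cmd} {Q : St → Prop} {s : St}
    (h : wp V N I c₁ (wp V N I c₂ Q) s) : wp V N I (c₁ ;; c₂) Q s := h

/-- A bound for the running time of a command without loops. -/
def Cmd.cost : Cmd → ℕ
  | seq c₁ c₂ => c₁.cost + c₂.cost
  | ite _ c₁ c₂ => max c₁.cost c₂.cost + 4
  | skip => 0
  | _ => 60

/-- Soundness of `wp`, by symbolic execution of each primitive. The unit cost `60` exceeds the
longest primitive code, the `52` instructions of `eq`. -/
theorem wp.runs (hN : N ≤ V) (hI : ∀ j, I j ≤ V) {c : Cmd} : ∀ {Q : St → Prop} {s : St},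
    c.bound ≤ V → wp V N I c Q s → Runs V N I c c.cost s Q := by
  induction c with
  | seq c₁ c₂ ih₁ ih₂ =>
    intro Q s hV h
    simp only [Cmd.bound] at hV
    exact (ih₁ (by omega) h).seq fun s' h' => ih₂ (by omega) h'
  | ite x c₁ c₂ ih₁ ih₂ =>
    intro Q s hV h
    simp only [Cmd.bound] at hV
    exact .ite (by omega) (fun hx => (ih₁ (by omega) (h.1 hx)).mono (le_max_left _ _) fun _ => id)
      fun hx => (ih₂ (by omega) (h.2 hx)).mono (le_max_right _ _) fun _ => id
  | loop => exact fun _ h => h.elim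
  | skip =>
    intro Q s hV h
    exact runs_prim (c := .skip) (fun _ => rfl) fun g hr => ⟨hr.bounded, s, hr, h⟩
  | const x j =>
    intro Q s hV h
    simp only [Cmd.bound] at hV
    refine (runs_prim (c := .const x j) (fun _ => rfl) fun g hr => ?_).mono (by simp [Cmd.prim,
      stI, Cmd.cost]) fun _ => id
    have hb := hr.bounded
    refine ⟨hb, trivial, chain_stI (by omega) hb.2.1 hb.2.2 (by omega) fun pc => ⟨_,
      hr.set ?_ ?_ ?_, h⟩⟩
    · omega
    · exact addr_le _ (by omega)
    · omega
  | getN x =>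
    intro Q s hV h
    simp only [Cmd.bound] at hV
    refine (runs_prim (c := .getN x) (fun _ => rfl) fun g hr => ?_).mono (by simp [Cmd.prim, stI,
      Cmd.cost]) fun _ => id
    have hb := hr.bounded
    refine ⟨hb, trivial, chain_stI (by omega) hb.2.1 hb.2.2 (by omega) fun pc => ⟨_,
      hr.set hN ?_ ?_, h⟩⟩
    · exact addr_le _ (by omega)
    · omega
  | inp x j =>
    intro Q s hV h
    simp only [Cmd.bound] at hV
    refine (runs_prim (c := .inp x j) (fun _ => rfl) fun g hr => ?_).mono (by simp [Cmd.prim, stI,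
      Cmd.cost]) fun _ => id
    have hb := hr.bounded
    have hj := hI j
    refine ⟨hb, trivial, ⟨by simp only [exec]; omega, hb.2⟩, trivial,
      chain_stI (by simp only [exec]; omega) hb.2.1 hb.2.2 (by omega) fun pc => ⟨_,
      hr.set hj ?_ ?_, h⟩⟩
    · exact addr_le _ (by omega)
    · simp only [exec]; omega
  | add x y z =>
    intro Q s hV h
    simp only [Cmd.bound] at hV
    refine (runs_prim (c := .add x y z) (fun _ => rfl) fun g hr => ?_).mono (by simp [Cmd.prim,
      stI, ldI, Cmd.cost]) fun _ => id
    have hb := hr.bounded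
    have hy := hr.le y.1 y.2
    have hz := hr.le z.1 z.2
    have h1 := h.1
    simp only [Cmd.prim, List.append_assoc, List.cons_append, List.nil_append]
    refine .append (chain_ldI hb.1 hb.2.1 hb.2.2 (by omega) fun pc => ?_)
    refine ⟨⟨hb.2.2 _, hb.2⟩, trivial,
      .append (chain_ldI (x := z) (hb.2.2 _) (hb.2.2 _) hb.2.2 (by omega) fun pc => ?_)⟩
    simp only [hr.mem_eq]
    refine ⟨⟨by simp only []; omega, by simp only []; omega, hb.2.2⟩, trivial,
      chain_stI (by simp only []; omega) (by simp only []; omega) hb.2.2 (by omega) fun pc => ⟨_,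
      hr.set ?_ ?_ ?_, by simpa only [add_comm] using h.2⟩⟩
    · simp only []; omega
    · exact addr_le _ (by omega)
    · simp only []; omega
  | addc x y j =>
    intro Q s hV h
    simp only [Cmd.bound] at hV
    refine (runs_prim (c := .addc x y j) (fun _ => rfl) fun g hr => ?_).mono (by simp [Cmd.prim,
      stI, ldI, Cmd.cost]) fun _ => id
    have hb := hr.bounded
    have hy := hr.le y.1 y.2
    have h1 := h.1
    simp only [Cmd.prim, List.append_assoc]
    refine .append (chain_ldI hb.1 hb.2.1 hb.2.2 (by omega) fun pc => ?_)
    simp only [hr.mem_eq]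
    refine ⟨⟨by simp only []; omega, hb.2⟩, trivial, ⟨by simp only [exec]; omega,
      by simp only [exec]; omega, hb.2.2⟩, trivial, ⟨by simp only [exec]; omega,
      by simp only [exec]; omega, hb.2.2⟩, trivial,
      chain_stI (by simp only [exec]; omega) (by simp only [exec]; omega) hb.2.2 (by omega)
      fun pc => ⟨_, hr.set ?_ ?_ ?_, by simpa only [exec, add_comm] using h.2⟩⟩
    · simp only [exec]; omega
    · exact addr_le _ (by omega)
    · simp only [exec]; omega
  | out x =>
    intro Q s hV h
    simp only [Cmd.bound] at hV
    refine (runs_prim (c := .out x) (fun _ => rfl) fun g hr => ?_).mono (by simp [Cmd.prim, ldI,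
      Cmd.cost]) fun _ => id
    have hb := hr.bounded
    simp only [Cmd.prim]
    refine .append (chain_ldI hb.1 hb.2.1 hb.2.2 (by omega) fun pc => ?_)
    refine ⟨⟨hb.2.2 _, hb.2⟩, trivial, ⟨hb.2.2 _, hb.2⟩, { s with out := s.out ++ [s.σ x.1 x.2] },
      ⟨⟨hb.2.2 _, hb.2⟩, ?_, hr.mem_eq, hr.le⟩, h⟩
    simp [exec, hr.mem_eq, hr.out_eq]
  | look x t y =>
    intro Q s hV h
    simp only [Cmd.bound] at hV
    refine (runs_prim (c := .look x t y) (fun _ => rfl) fun g hr => ?_).mono (by simp [Cmd.prim,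
      stI, ldI, adrI, Cmd.cost]) fun _ => id
    have hb := hr.bounded
    have hy := hr.le y.1 y.2
    have ht := t.idx_lt
    simp only [Cmd.prim, List.append_assoc]
    refine .append (chain_ldI hb.1 hb.2.1 hb.2.2 (by omega) fun pc => ?_)
    simp only [hr.mem_eq]
    refine .append (chain_adrI hy hb.2.1 hb.2.2 (by omega) fun pc => ?_)
    refine ⟨⟨by simp only []; omega, by simp only []; omega, hb.2.2⟩, trivial, ?_⟩
    have e : g.mem (32 * s.σ y.1 y.2 + t.idx) = s.σ t (s.σ y.1 y.2) := hr.mem_eq t _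
    have hv := hr.le t (s.σ y.1 y.2)
    simp only [exec, e]
    refine chain_stI (by omega) (by omega) hb.2.2 (by omega) fun pc => ⟨_, hr.set hv ?_ ?_, h⟩
    · exact addr_le _ (by omega)
    · omega
  -- The target address is parked in register `30` while `A` and `B` fetch the value.
  | put t y x =>
    intro Q s hV h
    simp only [Cmd.bound] at hV
    refine (runs_prim (c := .put t y x) (fun _ => rfl) fun g hr => ?_).mono (by simp [Cmd.prim,
      ldI, adrI, Cmd.cost]) fun _ => id
    have hb := hr.bounded
    have hy := hr.le y.1 y.2
    have hx := hr.le x.1 x.2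
    have ht := t.idx_lt
    simp only [Cmd.prim, List.append_assoc]
    refine .append (chain_ldI hb.1 hb.2.1 hb.2.2 (by omega) fun pc => ?_)
    simp only [hr.mem_eq]
    refine .append (chain_adrI hy hb.2.1 hb.2.2 (by omega) fun pc => ?_)
    have hr' := hr.hidden (p := 30) (v := 32 * s.σ y.1 y.2 + t.idx) (by omega) (by omega)
    refine .append (chain_save (by omega) (by omega) hb.2.2 (by omega) fun pc => ?_)
    have hb' := hr'.bounded.2.2
    have hm := hr'.mem_eq x.1 x.2
    have h30 : Function.update g.mem 30
      (32 * s.σ y.1 y.2 + t.idx) 30 = 32 * s.σ y.1 y.2 + t.idx := by simp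
    simp only at hb' hm
    refine .append (chain_ldI (by omega) (by omega) hb' (by omega) fun pc => ?_)
    simp only [hm]
    simp only [Chain, exec, h30, Config.BoundedBy, Instr.Straight]
    refine ⟨⟨by omega, by omega, hb'⟩, trivial, ⟨by omega, by omega, hb'⟩, trivial, ⟨by omega,
      by omega, hb'⟩, trivial, ⟨by omega, by omega, hb'⟩, trivial, ⟨by omega, by omega,
      update_le hb' (by omega)⟩, _, hr'.set (x := (t, s.σ y.1 y.2)) hx ?_ ?_, h⟩ <;> omega
  -- Equality is tested through memory: `0` is written to `32 * u + 31`, then `1` to `32 * w + 31`,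
  -- and the first address is read back. It contains `1` exactly when the addresses coincide. Both
  -- addresses are parked in registers `30` and `62`.
  | eq x y z =>
    intro Q s hV h
    simp only [Cmd.bound] at hV
    refine (runs_prim (c := .eq x y z) (fun _ => rfl) fun g hr => ?_).mono (by simp [Cmd.prim,
      stI, ldI, adrI, Cmd.cost]) fun _ => id
    have hb := hr.bounded
    have hy := hr.le y.1 y.2
    have hz := hr.le z.1 z.2
    simp only [wp] at h
    simp only [Cmd.prim, List.append_assoc]
    generalize hu : s.σ y.1 y.2 = u at *
    generalize hw : s.σ z.1 z.2 = w at *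
    refine .append (chain_ldI hb.1 hb.2.1 hb.2.2 (by omega) fun pc => ?_)
    simp only [hr.mem_eq, hu]
    refine .append (chain_adrI hy hb.2.1 hb.2.2 (by omega) fun pc => ?_)
    have hr1 := hr.hidden (p := 30) (v := 32 * u + 31) (by omega) (by omega)
    refine .append (chain_save (by omega) (by omega) hb.2.2 (by omega) fun pc => ?_)
    have hb1 := hr1.bounded.2.2
    have hm := hr1.mem_eq z.1 z.2
    simp only at hb1 hm
    refine .append (chain_ldI (by omega) (by omega) hb1 (by omega) fun pc => ?_)
    simp only [hm, hw]
    refine .append (chain_adrI hz (by omega) hb1 (by omega) fun pc => ?_)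
    have hr2 := hr1.hidden (p := 62) (v := 32 * w + 31) (by omega) (by omega)
    refine .append (chain_save (by omega) (by omega) hb1 (by omega) fun pc => ?_)
    have hb2 := hr2.bounded.2.2
    have hr3 := hr2.hidden (p := 32 * u + 31) (v := 0) (by omega) (by omega)
    have hr4 := hr3.hidden (p := 32 * w + 31) (v := 1) (by omega) (by omega)
    have hb3 := hr3.bounded.2.2
    have hb4 := hr4.bounded.2.2
    simp only at hb2 hb3 hb4
    set m2 := Function.update (Function.update g.mem 30 (32 * u + 31)) 62 (32 * w + 31) with hm2
    have e1 : m2 30 = 32 * u + 31 := by simp [hm2]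
    have e2 : Function.update m2 (32 * u + 31) 0 62 = 32 * w + 31 := by
      rw [Function.update_of_ne (by omega)]; simp [hm2]
    set m4 := Function.update (Function.update m2 (32 * u + 31) 0) (32 * w + 31) 1 with hm4
    have e3 : m4 30 = 32 * u + 31 := by
      rw [hm4, Function.update_of_ne (by omega), Function.update_of_ne (by omega), e1]
    have e4 : m4 (32 * u + 31) = if u = w then 1 else 0 := by
      rw [hm4, Function.update_apply]
      simp
    have e5 : (if u = w then 1 else 0) ≤ 1 := by split_ifs <;> omega
    simp only [Chain, List.cons_append, List.nil_append, exec, e1, e2, ← hm4, e3, e4,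
      Config.BoundedBy, Instr.Straight,
      hb2, hb3, hb4, implies_true, and_true, true_and]
    refine ⟨by omega, by omega, by omega, by omega, by omega, by omega, by omega, by omega,
      by omega, by omega, by omega, by omega, by omega, ?_⟩
    refine chain_stI (by omega) (by omega) hb4 (by omega) fun pc => ⟨_, hr4.set ?_ ?_ ?_, h⟩
    · omega
    · exact addr_le _ (by omega)
    · omega

end Primitive

/-! ### Positional numerals -/

/-- The value of the first `n` digits `f 0, f 1, …` in base `K`, least significant first. -/
def val (K : ℕ) (f : ℕ → ℕ) (n : ℕ) : ℕ := ∑ i ∈ Finset.range n, f i * K ^ i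

/-- The first `n` values of `f` are digits in base `K`. -/
def Digits (K n : ℕ) (f : ℕ → ℕ) : Prop := ∀ i < n, f i < K

section Val

variable {K n m : ℕ} {f g : ℕ → ℕ}

@[simp] theorem val_zero : val K f 0 = 0 := rfl

theorem val_succ : val K f (n + 1) = val K f n + f n * K ^ n := Finset.sum_range_succ _ _

theorem val_succ' : val K f (n + 1) = f 0 + K * val K (fun i => f (i + 1)) n := by
  rw [val, Finset.sum_range_succ', val, Finset.mul_sum, add_comm, pow_zero, mul_one]
  exact congrArg _ (Finset.sum_congr rfl fun i _ => by ring)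

theorem val_congr (h : ∀ i < n, f i = g i) : val K f n = val K g n :=
  Finset.sum_congr rfl fun i hi => by rw [h i (Finset.mem_range.1 hi)]

theorem val_eq_zero (h : ∀ i < n, f i = 0) : val K f n = 0 :=
  Finset.sum_eq_zero fun i hi => by rw [h i (Finset.mem_range.1 hi), zero_mul]

theorem Digits.mono (h : Digits K n f) (hm : m ≤ n) : Digits K m f :=
  fun i hi => h i (hi.trans_le hm)

theorem Digits.val_lt (h : Digits K n f) : val K f n < K ^ n := by
  induction n with
  | zero => simp
  | succ n ih =>
    have h1 := ih (h.mono n.le_succ)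
    have h2 := Nat.mul_le_mul_right (K ^ n) (Nat.succ_le_of_lt (h n n.lt_succ_self))
    rw [val_succ, pow_succ']
    rw [Nat.succ_eq_add_one, add_mul] at h2
    omega

theorem val_mono (h : m ≤ n) : val K f m ≤ val K f n :=
  Finset.sum_le_sum_of_subset (Finset.range_mono h)

/-- A value below `K ^ m` leaves no room for a nonzero digit at a position from `m` on. -/
theorem val_eq_of_lt (hK : 0 < K) (hm : m ≤ n)
    (h : val K f n < K ^ m) :
    val K f m = val K f n := by
  induction n, hm using Nat.le_induction with
  | base => rfl
  | succ n hmn ih =>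
    rw [val_succ] at h ⊢
    rw [ih (by omega)]
    have h1 : K ^ m ≤ K ^ n := Nat.pow_le_pow_right hK hmn
    have h2 : f n = 0 := by
      by_contra h0
      have := Nat.mul_le_mul_right (K ^ n) (Nat.one_le_iff_ne_zero.2 h0)
      omega
    simp [h2]

/-- Splitting off the leading digits. -/
theorem val_split (h : m ≤ n) :
    val K f n = val K f m + K ^ m * val K (fun i => f (m + i)) (n - m) := by
  obtain ⟨k, rfl⟩ := Nat.exists_eq_add_of_le h
  rw [Nat.add_sub_cancel_left, val, Finset.sum_range_add, val, val, Finset.mul_sum]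
  exact congrArg _ (Finset.sum_congr rfl fun i _ => by ring)

/-- At each position the two digits add up to `K - 1`, and the numeral with all digits `K - 1` has
the value `K ^ n - 1`. -/
theorem val_compl (hf : Digits K n f) (hg : ∀ i < n, g i = K - 1 - f i) :
    val K g n + val K f n + 1 = K ^ n := by
  induction n with
  | zero => simp
  | succ n ih =>
    have h1 := ih (hf.mono n.le_succ) fun i hi => hg i (by omega)
    have h2 := hf n n.lt_succ_self
    have h3 : g n + f n + 1 = K := by rw [hg n n.lt_succ_self]; omega
    rw [val_succ, val_succ, pow_succ]
    calc _ = (val K g n + val K f n + 1) + (g n + f n) * K ^ n := by ring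
      _ = K ^ n * (g n + f n + 1) := by rw [h1]; ring
      _ = _ := by rw [h3]

theorem val_update {k v : ℕ} (hk : k < n) (h : f k = 0) :
    val K (Function.update f k v) n = val K f n + v * K ^ k := by
  have e : ∀ i ∈ Finset.range n, Function.update f k v i * K ^ i =
      f i * K ^ i + if i = k then v * K ^ k else 0 := by
    intro i _
    rw [Function.update_apply]
    split_ifs with hi
    · rw [hi, h]; ring
    · simp
  rw [val, Finset.sum_congr rfl e, Finset.sum_add_distrib, Finset.sum_ite_eq',
    if_pos (Finset.mem_range.2 hk), val]

theorem val_digits {K n x : ℕ} (hx : x < K ^ n) : val K (fun i => x / K ^ i % K) n = x := by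
  induction n generalizing x with
  | zero => simp only [pow_zero] at hx; simp; omega
  | succ n ih =>
    rw [val_succ']
    have : val K (fun i => x / K ^ (i + 1) % K) n = x / K := by
      rw [← ih (x := x / K) (Nat.div_lt_of_lt_mul (by rwa [← pow_succ']))]
      exact val_congr fun i _ => by rw [pow_succ', ← Nat.div_div_eq_div_mul]
    rw [this]
    simp [Nat.mod_add_div]

end Val

/-! ### Frames, unrolled repetition and array operations -/

/-- `s'` agrees with `s` except for the cells of the classes `l`. -/
structure Frame (l : List Cls) (s s' : St) : Prop where
  σ_eq : ∀ t, t ∉ l → s'.σ t = s.σ t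
  out_eq : s'.out = s.out

theorem Frame.refl {l : List Cls} {s : St} : Frame l s s := ⟨fun _ _ => rfl, rfl⟩

theorem Frame.trans {l : List Cls} {s₁ s₂ s₃ : St} (h₁ : Frame l s₁ s₂) (h₂ : Frame l s₂ s₃) :
    Frame l s₁ s₃ :=
  ⟨fun t ht => (h₂.1 t ht).trans (h₁.1 t ht), h₂.2.trans h₁.2⟩

theorem Frame.weaken {l l' : List Cls} {s s' : St} (h : Frame l s s') (hl : l ⊆ l') :
    Frame l' s s' :=
  ⟨fun t ht => h.1 t fun h' => ht (hl h'), h.2⟩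

theorem Frame.set {l : List Cls} {s s' : St} {x : Cell} {v : ℕ} (h : Frame l s s') (hx : x.1 ∈ l) :
    Frame l s (s'.set x v) :=
  ⟨fun t ht => by
    rw [St.set_ne]
    · exact h.1 t ht
    · rintro rfl; exact ht hx, h.2⟩

/-- `f 0, …, f (n - 1)` one after the other. -/
def rep (f : ℕ → Cmd) : ℕ → Cmd
  | 0 => .skip
  | n + 1 => rep f n ;; f n

/-- `f (n - 1), …, f 0` one after the other. -/
def repDown (f : ℕ → Cmd) : ℕ → Cmd
  | 0 => .skip
  | n + 1 => f n ;; repDown f n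

section Rep

variable {V N : ℕ} {I : ℕ → ℕ}

/-- The repetition is unrolled in the program text, so an invariant indexed by the position suffices
and no machine loop is involved. -/
theorem wp_rep {f : ℕ → Cmd} (Inv : ℕ → St → Prop) {n : ℕ} {s : St} (h0 : Inv 0 s)
    (h : ∀ k < n, ∀ s, Inv k s → wp V N I (f k) (Inv (k + 1)) s) :
    wp V N I (rep f n) (Inv n) s := by
  induction n with
  | zero => exact h0
  | succ n ih =>
    change wp V N I (rep f n) (wp V N I (f n) _) s
    exact wp_mono (ih fun k hk => h k (by omega)) (h n n.lt_succ_self)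

theorem wp_repDown {f : ℕ → Cmd} (Inv : ℕ → St → Prop) {n : ℕ} {s : St} (h0 : Inv n s)
    (h : ∀ k < n, ∀ s, Inv (k + 1) s → wp V N I (f k) (Inv k) s) :
    wp V N I (repDown f n) (Inv 0) s := by
  induction n generalizing s with
  | zero => exact h0
  | succ n ih =>
    change wp V N I (f n) (wp V N I (repDown f n) _) s
    exact wp_mono (h n n.lt_succ_self s h0) fun s' hs' => ih hs' fun k hk => h k (by omega)

theorem cost_rep {f : ℕ → Cmd} {n c : ℕ} (h : ∀ k < n, (f k).cost ≤ c) :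
    (rep f n).cost ≤ n * c := by
  induction n with
  | zero => simp [rep, Cmd.cost]
  | succ n ih =>
    have h1 := ih fun k hk => h k (by omega)
    have h2 := h n n.lt_succ_self
    simp only [rep, Cmd.cost, add_mul, one_mul]
    omega

theorem cost_repDown {f : ℕ → Cmd} {n c : ℕ} (h : ∀ k < n, (f k).cost ≤ c) :
    (repDown f n).cost ≤ n * c := by
  induction n with
  | zero => simp [repDown, Cmd.cost]
  | succ n ih =>
    have h1 := ih fun k hk => h k (by omega)
    have h2 := h n n.lt_succ_self
    simp only [repDown, Cmd.cost, add_mul, one_mul]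
    omega

/-- Filling an array with values that do not depend on it. -/
theorem wp_fill {f : ℕ → Cmd} {t : Cls} {n : ℕ} {g : ℕ → ℕ} {s : St} {Q : St → Prop}
    (hf : ∀ i < n, ∀ s', Frame [t] s s' → ∀ R : St → Prop, R (s'.set (t, i) (g i)) →
      wp V N I (f i) R s')
    (hQ : ∀ s', Frame [t] s s' → (∀ i < n, s'.σ t i = g i) → Q s') :
    wp V N I (rep f n) Q s := by
  refine wp_mono (wp_rep (fun k s' => Frame [t] s s' ∧ ∀ i < k, s'.σ t i = g i)
    ⟨.refl, by simp⟩ ?_) fun s' h => hQ s' h.1 h.2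
  rintro k hk s' ⟨h1, h2⟩
  refine hf k hk s' h1 _ ⟨h1.set (by simp), fun i hi => ?_⟩
  rw [St.set_same, Function.update_apply]
  split_ifs with h
  · rw [h]
  · exact h2 i (by omega)

/-- The array `t` becomes a copy of the array `u`. -/
def copy (t u : Cls) (n : ℕ) : Cmd := rep (fun i => .addc (t, i) (u, i) 0) n

theorem wp_copy {t u : Cls} {n : ℕ} {s : St} {Q : St → Prop} (htu : u ≠ t)
    (hV : ∀ i < n, s.σ u i ≤ V)
    (hQ : ∀ s', Frame [t] s s' → (∀ i < n, s'.σ t i = s.σ u i) → Q s') :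
    wp V N I (copy t u n) Q s :=
  wp_fill (fun i hi s' hs' R hR => by
    simpa [wp, hs'.1 u (by simpa using htu)] using ⟨hV i hi, hR⟩) hQ

/-- The array `t` becomes a copy of the array `u` shifted by one position. -/
def copyShift (t u : Cls) : ℕ → Cmd := rep fun
  | 0 => .const (t, 0) 0
  | i + 1 => .addc (t, i + 1) (u, i) 0

theorem wp_copyShift {t u : Cls} {n : ℕ} {s : St} {Q : St → Prop} (htu : u ≠ t)
    (hV : ∀ i < n, s.σ u i ≤ V)
    (hQ : ∀ s', Frame [t] s s' → (∀ i < n, s'.σ t i = if i = 0 then 0 else s.σ u (i - 1)) → Q s') :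
    wp V N I (copyShift t u n) Q s :=
  wp_fill (fun i hi s' hs' R hR => by
    cases i with
    | zero => simpa [wp] using hR
    | succ i => simpa [wp, hs'.1 u (by simpa using htu)] using ⟨hV i (by omega), hR⟩) hQ

/-- The array `t` is filled with zeros. -/
def clear (t : Cls) (n : ℕ) : Cmd := rep (fun i => .const (t, i) 0) n

theorem wp_clear {t : Cls} {n : ℕ} {s : St} {Q : St → Prop}
    (hQ : ∀ s', Frame [t] s s' → (∀ i < n, s'.σ t i = 0) → Q s') : wp V N I (clear t n) Q s :=
  wp_fill (fun i hi s' hs' R hR => by simpa [wp] using hR) hQ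

end Rep

/-! ### Look-up tables and multiplication by a digit -/

/-- The look-up tables, for the base `K`. -/
structure Tables (K : ℕ) (σ : Cls → ℕ → ℕ) : Prop where
  div : ∀ v < K ^ 5, σ .tDiv v = v / K
  mod : ∀ v < K ^ 5, σ .tMod v = v % K
  mul : ∀ v < K ^ 5, σ .tMul v = (v / K) * (v % K)
  quot : ∀ v < K ^ 5, σ .tQuot v = v / K ^ 2 / (v % K ^ 2 + 1)
  shift : ∀ v < K ^ 4, σ .tShift v = v * K
  compl : ∀ v < K, σ .tCompl v = K - 1 - v

/-- The classes of the tables. -/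
def tableCls : List Cls := [.tDiv, .tMod, .tMul, .tQuot, .tShift, .tCompl]

theorem Tables.frame {K : ℕ} {s s' : St} {l : List Cls} (h : Tables K s.σ) (hs : Frame l s s')
    (hl : ∀ t ∈ tableCls, t ∉ l) : Tables K s'.σ := by
  have e : ∀ t ∈ tableCls, s'.σ t = s.σ t := fun t ht => hs.1 t (hl t ht)
  simp only [tableCls, List.forall_mem_cons, List.not_mem_nil, false_implies, implies_true,
    and_true] at e
  obtain ⟨h1, h2, h3, h4, h5, h6⟩ := e
  constructor
  · rw [h1]; exact h.div
  · rw [h2]; exact h.mod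
  · rw [h3]; exact h.mul
  · rw [h4]; exact h.quot
  · rw [h5]; exact h.shift
  · rw [h6]; exact h.compl

/-- One digit of the multiplication by a digit. -/
def addmulStep (X : Cls) (s k : ℕ) : Cmd :=
  .add (.wrk, 0) (.mltK, 0) (X, k) ;; .look (.wrk, 0) .tMul (.wrk, 0) ;;
  .add (.wrk, 0) (.wrk, 0) (.tmp, s + k) ;; .add (.wrk, 0) (.wrk, 0) (.car, 0) ;;
  .look (.tmp, s + k) .tMod (.wrk, 0) ;; .look (.car, 0) .tDiv (.wrk, 0)

/-- Add to `tmp` from position `s` on the product of the digit `mlt` and the `n` digits of `X`;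
the carry is `car`. -/
def addmul (X : Cls) (s n : ℕ) : Cmd :=
  .look (.mltK, 0) .tShift (.mlt, 0) ;; rep (addmulStep X s) n

section Query

variable {V N K : ℕ} {I : ℕ → ℕ}

/-- Schoolbook multiplication. For digits `q`, `x`, `d` and a carry `c < K` one has `q * x + d + c <
K ^ 2`, so the new carry is again less than `K`. The product is looked up at the index `q * K + x`.
The final equation says that no value is lost when the carry is counted with the weight of the next
position. -/
theorem wp_addmul {X : Cls} {s n D : ℕ} {st : St} (hK : 2 ≤ K) (hV : 2 * K ^ 5 ≤ V)
    (hX : X ∉ [Cls.tmp, .wrk, .car, .mltK]) (hD : s + n ≤ D) (ht : Tables K st.σ)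
    (hq : st.σ .mlt 0 < K) (hc : st.σ .car 0 < K) (hT : Digits K D (st.σ .tmp))
    (hX' : Digits K n (st.σ X)) :
    wp V N I (addmul X s n) (fun st' =>
      Frame [.tmp, .wrk, .car, .mltK] st st' ∧ Digits K D (st'.σ .tmp) ∧
      (∀ i, s + n ≤ i → st'.σ .tmp i = st.σ .tmp i) ∧
      val K (st'.σ .tmp) (s + n) + K ^ (s + n) * st'.σ .car 0 =
        val K (st.σ .tmp) (s + n) + st.σ .mlt 0 * K ^ s * val K (st.σ X) n +
          K ^ s * st.σ .car 0) st := by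
  have hK4 : K < K ^ 4 := by
    calc K = K ^ 1 := (pow_one K).symm
      _ < K ^ 4 := Nat.pow_lt_pow_right (by omega) (by norm_num)
  have hK25 : K * K ≤ K ^ 5 := by
    calc K * K = K ^ 2 := by ring
      _ ≤ K ^ 5 := Nat.pow_le_pow_right (by omega) (by norm_num)
  refine wp_mono (wp_rep (V := V) (N := N) (I := I)
    (fun k st' => Frame [.tmp, .wrk, .car, .mltK] st st' ∧ Digits K D (st'.σ .tmp) ∧
      (∀ i, s + k ≤ i → st'.σ .tmp i = st.σ .tmp i) ∧
      st'.σ .mltK 0 = st.σ .mlt 0 * K ∧ st'.σ .car 0 < K ∧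
      val K (st'.σ .tmp) (s + k) + K ^ (s + k) * st'.σ .car 0 =
        val K (st.σ .tmp) (s + k) + st.σ .mlt 0 * K ^ s * val K (st.σ X) k +
          K ^ s * st.σ .car 0) (n := n) ?_ ?_) ?_
  · refine ⟨Frame.refl.set (by simp), by simpa using hT, by simp, ?_, by simpa using hc, by simp⟩
    simp [ht.shift _ (hq.trans hK4)]
  · rintro k hk st' ⟨hF, hT', hi, hqK, hc', hv⟩
    have ht' : Tables K st'.σ := ht.frame hF (by decide)
    have hx : st'.σ X k < K := by rw [hF.1 X hX]; exact hX' k hk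
    have hd := hT' (s + k) (by omega)
    have hxe : st'.σ X k = st.σ X k := by rw [hF.1 X hX]
    generalize hx' : st'.σ X k = x at *
    generalize hd' : st'.σ .tmp (s + k) = d at *
    generalize hc'' : st'.σ .car 0 = c at *
    generalize hq' : st.σ .mlt 0 = q at *
    have b1 : q * K + x < K * K := by nlinarith
    have b2 : (q * K + x) / K = q := by
      rw [mul_comm, Nat.mul_add_div (by omega), Nat.div_eq_of_lt hx, add_zero]
    have b3 : (q * K + x) % K = x := by
      rw [mul_comm, Nat.mul_add_mod, Nat.mod_eq_of_lt hx]
    have b4 : q * x + d + c < K * K := by nlinarith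
    have m1 := ht'.mul (q * K + x) (by omega)
    rw [b2, b3] at m1
    have m2 := ht'.mod (q * x + d + c) (by omega)
    have m3 := ht'.div (q * x + d + c) (by omega)
    have hlt : (q * x + d + c) / K < K := Nat.div_lt_of_lt_mul b4
    have hdm := Nat.mod_add_div (q * x + d + c) K
    simp only [addmulStep, wp, St.set_same, St.set_ne, Function.update_self, ne_eq, reduceCtorEq,
      not_false_eq_true, hqK, hx', hd', hc'', m1, m2, m3]
    refine ⟨by omega, by omega, by omega, ?_, ?_, ?_, ?_, ?_, ?_⟩
    · exact ((((((hF.set (by simp)).set (by simp)).set (by simp)).set (by simp)).set (by simp)).set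
        (by simp))
    · intro i hi
      rw [Function.update_apply]
      split_ifs
      · exact Nat.mod_lt _ (by omega)
      · exact hT' i hi
    · intro i hi'
      rw [Function.update_of_ne (by omega)]
      exact hi i (by omega)
    · trivial
    · exact hlt
    · rw [← add_assoc, val_succ, val_succ, val_succ, Function.update_self]
      rw [val_congr (g := st'.σ .tmp) fun i hi => Function.update_of_ne (by omega) _ _]
      rw [← hi (s + k) le_rfl, hd', ← hxe]
      generalize (q * x + d + c) / K = u at *
      generalize (q * x + d + c) % K = w at *
      calc _ = val K (st'.σ .tmp) (s + k) + K ^ (s + k) * (w + K * u) := by ring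
        _ = (val K (st'.σ .tmp) (s + k) + K ^ (s + k) * c) + K ^ (s + k) * (q * x + d) := by
          rw [hdm]; ring
        _ = _ := by rw [hv]; ring
  · rintro st' ⟨h1, h2, h3, -, -, h4⟩
    exact ⟨h1, h2, h3, h4⟩

end Query

/-! ### Conditional subtraction and long division -/

/-- If `mlt * K ^ s` times the divisor is at most `rem`, subtract it from there and add `mlt` to
the digit `s` of the quotient. -/
def trySub (D s : ℕ) : Cmd :=
  copy .tmp .rem D ;; .addc (.car, 0) (.mlt, 0) 0 ;; addmul .compl s (D - s) ;;
  .eq (.flg, 0) (.car, 0) (.mlt, 0) ;;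
  .ite (.flg, 0) (copy .rem .tmp D ;; .add (.quo, s) (.quo, s) (.mlt, 0)) .skip

/-- The classes changed by `trySub`. -/
def trySubCls : List Cls := [.rem, .quo, .tmp, .wrk, .car, .mltK, .flg]

/-- `compl` holds the complements of the digits of the divisor `b`. -/
structure Divisor (K D b : ℕ) (σ : Cls → ℕ → ℕ) : Prop where
  digits : Digits K D (σ .dvs)
  val_eq : val K (σ .dvs) D = b
  compl : ∀ i < D, σ .compl i = K - 1 - σ .dvs i

theorem Divisor.frame {K D b : ℕ} {s s' : St} {l : List Cls} (h : Divisor K D b s.σ)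
    (hs : Frame l s s') (h1 : Cls.dvs ∉ l) (h2 : Cls.compl ∉ l) : Divisor K D b s'.σ := by
  constructor
  · rw [hs.1 _ h1]; exact h.digits
  · rw [hs.1 _ h1]; exact h.val_eq
  · rw [hs.1 _ h1, hs.1 _ h2]; exact h.compl

section Query

variable {V N K : ℕ} {I : ℕ → ℕ}

/-- The first `D - s` complement digits have the value `K ^ (D - s) - 1 - b`. Adding `q * K ^ s`
times this with initial carry `q` turns `r` into `r + q * K ^ D - q * (b * K ^ s)`. The outgoing
carry is therefore `q` exactly when the subtraction is possible, and then the `D` digits of `tmp`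
are the difference. -/
theorem wp_trySub {s D b q r : ℕ} {st : St} (hK : 2 ≤ K) (hV : 2 * K ^ 5 ≤ V)
    (ht : Tables K st.σ) (hb : Divisor K D b st.σ) (hs : s ≤ D) (hbs : b * K ^ s < K ^ D)
    (hq : st.σ .mlt 0 = q) (hqK : q < K) (hQ : st.σ .quo s ≤ K)
    (hR : Digits K D (st.σ .rem)) (hr : val K (st.σ .rem) D = r) :
    wp V N I (trySub D s) (fun st' =>
      Frame trySubCls st st' ∧ Digits K D (st'.σ .rem) ∧
      if q * (b * K ^ s) ≤ r then val K (st'.σ .rem) D = r - q * (b * K ^ s) ∧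
        st'.σ .quo = Function.update (st.σ .quo) s (st.σ .quo s + q)
      else val K (st'.σ .rem) D = r ∧ st'.σ .quo = st.σ .quo) st := by
  have hK5 : K ≤ K ^ 5 := Nat.le_self_pow (by norm_num) K
  refine wp_copy (by decide) (fun i hi => by have := hR i hi; omega) fun s₁ hF₁ h₁ => ?_
  refine ⟨by rw [hF₁.1 _ (by decide), hq]; omega, ?_⟩
  simp only [add_zero]
  have hF₂ := hF₁.weaken (l' := trySubCls) (by decide) |>.set (x := (.car, 0))
    (v := s₁.σ .mlt 0) (by decide)
  have hmlt : s₁.σ .mlt 0 = q := by rw [hF₁.1 _ (by decide), hq]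
  generalize he : s₁.set (.car, 0) (s₁.σ .mlt 0) = s₂ at *
  have hT₂ : ∀ i < D, s₂.σ .tmp i = st.σ .rem i := by
    rw [← he]; simpa using h₁
  have hc₂ : s₂.σ .car 0 = q := by rw [← he]; simp [hmlt]
  have hm₂ : s₂.σ .mlt 0 = q := by rw [hF₂.1 _ (by decide), hq]
  have hb₂ := hb.frame hF₂ (by decide) (by decide)
  refine wp_seq (wp_addmul (X := .compl) (s := s) (n := D - s) (D := D) hK hV (by decide)
    (by omega) (ht.frame hF₂ (by decide))
    (by omega) (by omega) (fun i hi => by rw [hT₂ i hi]; exact hR i hi)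
    (fun i hi => by rw [hb₂.compl i (by omega)]; omega)) ?_
  rintro s₃ ⟨hF₃, hT₃, -, hv⟩
  rw [hm₂, hc₂, Nat.add_sub_cancel' hs, val_congr hT₂, hr] at hv
  -- The `s` top digits of the divisor vanish because `b * K ^ s < K ^ D`, so they may be cut off.
  have hbv : val K (s₂.σ .dvs) (D - s) = b := by
    rw [← hb₂.val_eq]
    refine val_eq_of_lt (by omega) (by omega) ?_
    rw [hb₂.val_eq]
    rw [← Nat.sub_add_cancel hs, pow_add] at hbs
    exact lt_of_mul_lt_mul_right hbs (Nat.zero_le _)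
  have hcv := val_compl (hb₂.digits.mono (Nat.sub_le D s)) fun i hi => hb₂.compl i (by omega)
  rw [hbv] at hcv
  have hpow : K ^ s * K ^ (D - s) = K ^ D := by rw [← pow_add, Nat.add_sub_cancel' hs]
  have hv' : val K (s₃.σ .tmp) D + K ^ D * s₃.σ .car 0 + q * (b * K ^ s) = r + q * K ^ D := by
    rw [hv, ← hpow, ← hcv]; ring
  have hF₃' := hF₂.trans (hF₃.weaken (l' := trySubCls) (by decide))
  have hm₃ : s₃.σ .mlt 0 = q := by rw [hF₃.1 _ (by decide), hm₂]
  have hlt := hT₃.val_lt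
  have hrlt : r < K ^ D := hr ▸ hR.val_lt
  have hle : s₃.σ .car 0 ≤ q := by
    by_contra h
    have := Nat.mul_le_mul_left (K ^ D) (Nat.succ_le_of_lt (not_le.1 h))
    rw [Nat.succ_eq_add_one, mul_add, mul_comm _ q] at this
    omega
  have hiff : s₃.σ .car 0 = q ↔ q * (b * K ^ s) ≤ r := by
    constructor
    · intro h
      rw [h, mul_comm (K ^ D)] at hv'
      omega
    · intro h
      by_contra h'
      have := Nat.mul_le_mul_left (K ^ D) (Nat.succ_le_of_lt (lt_of_le_of_ne hle h'))
      rw [Nat.succ_eq_add_one, mul_add, mul_comm _ q] at this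
      omega
  simp only [wp, St.set_same, Function.update_self, hm₃, hiff]
  split_ifs with hcase
  · refine ⟨fun _ => ?_, fun h => by simp at h⟩
    have hqe := hiff.2 hcase
    rw [hqe, mul_comm (K ^ D)] at hv'
    refine wp_copy (by decide) (fun i hi => ?_) fun s₄ hF₄ h₄ => ?_
    · have := hT₃ i hi
      simp only [ne_eq, reduceCtorEq, not_false_eq_true, St.set_ne]
      omega
    · have hquo : s₄.σ .quo = st.σ .quo := by
        rw [hF₄.1 _ (by decide), St.set_ne _ _ _ (by decide), hF₃.1 _ (by decide), ← he,
          St.set_ne _ _ _ (by decide), hF₁.1 _ (by decide)]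
      have hm₄ : s₄.σ .mlt 0 = q := by
        rw [hF₄.1 _ (by decide), St.set_ne _ _ _ (by decide), hm₃]
      simp only [ne_eq, reduceCtorEq, not_false_eq_true, St.set_ne] at h₄
      simp only [hquo, hm₄, ne_eq, reduceCtorEq, not_false_eq_true, St.set_ne]
      refine ⟨by omega, ?_, fun i hi => ?_, ?_, trivial⟩
      · exact ((hF₃'.set (by decide)).trans (hF₄.weaken (by decide))).set
          (by simp [trySubCls])
      · rw [h₄ i hi]; exact hT₃ i hi
      · rw [val_congr h₄]; omega
  · refine ⟨fun h => by simp at h, fun _ => ?_⟩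
    have hrem : s₃.σ .rem = st.σ .rem := by
      rw [hF₃.1 _ (by decide), ← he, St.set_ne _ _ _ (by decide), hF₁.1 _ (by decide)]
    have hquo : s₃.σ .quo = st.σ .quo := by
      rw [hF₃.1 _ (by decide), ← he, St.set_ne _ _ _ (by decide), hF₁.1 _ (by decide)]
    simp only [ne_eq, reduceCtorEq, not_false_eq_true, St.set_ne, hrem, hquo]
    exact ⟨hF₃'.set (by decide), hR, hr, trivial⟩

/-- An estimate for one digit of the quotient, from the leading digits. -/
def divEst (m s : ℕ) : Cmd :=
  .look (.wrk, 0) .tShift (.rem, s + m + 1) ;; .add (.wrk, 0) (.wrk, 0) (.rem, s + m) ;;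
  .look (.wrk, 0) .tShift (.wrk, 0) ;; .add (.wrk, 0) (.wrk, 0) (.rem, s + m - 1) ;;
  .look (.wrk, 0) .tShift (.wrk, 0) ;; .add (.wrk, 0) (.wrk, 0) (.dvs, m) ;;
  .look (.wrk, 0) .tShift (.wrk, 0) ;; .add (.wrk, 0) (.wrk, 0) (.dvs, m - 1) ;;
  .look (.mlt, 0) .tQuot (.wrk, 0)

/-- One digit of the long division by a divisor with the leading digit at position `m`. -/
def divStep (D m s : ℕ) : Cmd :=
  divEst m s ;; trySub D s ;; .const (.mlt, 0) 1 ;; trySub D s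

theorem val_top₂ {n m : ℕ} {f : ℕ → ℕ} (hm : 1 ≤ m) (hmn : m < n) (h : val K f n < K ^ (m + 1))
    (hK : 0 < K) :
    val K f n = val K f (m - 1) + K ^ (m - 1) * (f m * K + f (m - 1)) := by
  obtain ⟨m, rfl⟩ : ∃ k, m = k + 1 := ⟨m - 1, by omega⟩
  rw [← val_eq_of_lt hK (by omega) h, val_succ, val_succ, Nat.add_sub_cancel]
  ring

theorem val_top₃ {n m : ℕ} {f : ℕ → ℕ} (hm : 1 ≤ m) (hmn : m + 1 < n)
    (h : val K f n < K ^ (m + 2)) (hK : 0 < K) :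
    val K f n = val K f (m - 1) + K ^ (m - 1) * ((f (m + 1) * K + f m) * K + f (m - 1)) := by
  obtain ⟨m, rfl⟩ : ∃ k, m = k + 1 := ⟨m - 1, by omega⟩
  rw [← val_eq_of_lt hK (by omega) h, val_succ, val_succ, val_succ, Nat.add_sub_cancel]
  ring

/-- The quotient of the leading digits of the remainder `f + P * ρ` and of the divisor `g + P * β`
is at most one less than the digit of the quotient. -/
theorem estimate {K P ρ β f g : ℕ} (hβ : K ≤ β) (hf : f < P) (hg : g < P)
    (hr : f + P * ρ < K * (g + P * β)) :
    ρ / (β + 1) * (g + P * β) ≤ f + P * ρ ∧ ρ / (β + 1) < K ∧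
      f + P * ρ < (ρ / (β + 1) + 2) * (g + P * β) := by
  have h1 := Nat.div_add_mod ρ (β + 1)
  have h2 : ρ % (β + 1) ≤ β := Nat.lt_succ_iff.1 (Nat.mod_lt _ (by omega))
  generalize ρ / (β + 1) = q at *
  generalize ρ % (β + 1) = u at *
  have hle : q * (g + P * β) ≤ f + P * ρ := by
    calc q * (g + P * β) ≤ q * (P + P * β) := by gcongr
      _ = P * ((β + 1) * q) := by ring
      _ ≤ P * ρ := by gcongr; omega
      _ ≤ _ := by omega
  have hq : q < K := lt_of_mul_lt_mul_right (hle.trans_lt hr) (Nat.zero_le _)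
  refine ⟨hle, hq, ?_⟩
  calc f + P * ρ < P + P * ρ := by omega
    _ = P * ((β + 1) * q + u + 1) := by rw [h1]; ring
    -- This needs `q + u + 1 ≤ 2 * β`, which holds as `q < K ≤ β` and `u ≤ β`.
    _ ≤ P * ((q + 2) * β) := by gcongr; nlinarith
    _ ≤ _ := by rw [mul_left_comm]; gcongr; omega

theorem mul_add_lt {a A K d : ℕ} (ha : a < A) (hd : d < K) : a * K + d < A * K := by
  nlinarith

/-- The shifted divisor has its leading digit at position `s + m`, and `r < K * (b * K ^ s)`
confines the remainder to positions up to `s + m + 1`. The packed index has the base-`K` digits `r2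
r1 r0 b1 b0`, which `tQuot` splits at `K ^ 2` into the two numbers of `estimate`. -/
theorem wp_divEst {m s D b r : ℕ} {st : St} (hK : 2 ≤ K) (hV : 2 * K ^ 5 ≤ V)
    (ht : Tables K st.σ) (hb : Divisor K D b st.σ) (hm : 1 ≤ m) (hD : s + m + 2 ≤ D)
    (hbl : K ^ m ≤ b) (hbu : b < K ^ (m + 1))  (hR : Digits K D (st.σ .rem)) (hr : val K
      (st.σ .rem) D = r) (hrb : r < K * (b * K ^ s)) :
    wp V N I (divEst m s) (fun st' => Frame [.wrk, .mlt] st st' ∧ st'.σ .mlt 0 < K ∧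
      st'.σ .mlt 0 * (b * K ^ s) ≤ r ∧ r < (st'.σ .mlt 0 + 2) * (b * K ^ s)) st := by
  have hK0 : 0 < K := by omega
  have hbs : b * K ^ s < K ^ (s + m + 1) := by
    calc b * K ^ s < K ^ (m + 1) * K ^ s := by gcongr
      _ = _ := by rw [← pow_add]; congr 1; omega
  have hr3 : r < K ^ (s + m + 2) := by
    calc r < K * (b * K ^ s) := hrb
      _ ≤ K * K ^ (s + m + 1) := by gcongr
      _ = _ := by ring
  have d2 := hR (s + m + 1) (by omega)
  have d1 := hR (s + m) (by omega)
  have d0 := hR (s + m - 1) (by omega)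
  have e1 := hb.digits m (by omega)
  have e0 := hb.digits (m - 1) (by omega)
  have er := val_top₃ (n := D) (m := s + m) (by omega) (by omega) (hr ▸ hr3) hK0
  have eb := val_top₂ (n := D) hm (by omega) (hb.val_eq ▸ hbu) hK0
  have fr := (hR.mono (m := s + m - 1) (by omega)).val_lt
  have fb := (hb.digits.mono (m := m - 1) (by omega)).val_lt
  rw [hr] at er
  rw [hb.val_eq] at eb
  generalize hr2 : st.σ .rem (s + m + 1) = r2 at *
  generalize hr1 : st.σ .rem (s + m) = r1 at *
  generalize hr0 : st.σ .rem (s + m - 1) = r0 at *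
  generalize hb1 : st.σ .dvs m = b1 at *
  generalize hb0 : st.σ .dvs (m - 1) = b0 at *
  generalize val K (st.σ .rem) (s + m - 1) = f at *
  generalize val K (st.σ .dvs) (m - 1) = g at *
  have hP : K ^ (m - 1) * K ^ s = K ^ (s + m - 1) := by rw [← pow_add]; congr 1; omega
  have eb' : b * K ^ s = g * K ^ s + K ^ (s + m - 1) * (b1 * K + b0) := by
    rw [eb, ← hP]; ring
  -- With a zero at position `m` the divisor would be below `K ^ m`. A nonzero leading digit gives
  -- `K ≤ b1 * K + b0`, as `estimate` requires.
  have hb1p : 1 ≤ b1 := by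
    rw [Nat.one_le_iff_ne_zero]
    rintro rfl
    have h1 : K ^ (m - 1) * (0 * K + b0) ≤ K ^ (m - 1) * (K - 1) := by gcongr; omega
    have h2 : K ^ (m - 1) * (K - 1) + K ^ (m - 1) = K ^ m := by
      rw [← Nat.mul_succ, Nat.succ_eq_add_one, Nat.sub_add_cancel (by omega), ← pow_succ,
        Nat.sub_add_cancel hm]
    omega
  obtain ⟨hle, hqK, hlt⟩ := estimate (K := K) (P := K ^ (s + m - 1))
    (ρ := (r2 * K + r1) * K + r0) (β := b1 * K + b0) (f := f) (g := g * K ^ s) (by nlinarith) fr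
    (by rw [← hP]; gcongr) (by rw [← eb', ← er]; exact hrb)
  rw [← eb', ← er] at hle hlt
  have w1 : r2 * K + r1 < K ^ 2 := by rw [pow_two]; exact mul_add_lt d2 d1
  have w2 : (r2 * K + r1) * K + r0 < K ^ 3 := by rw [pow_succ]; exact mul_add_lt w1 d0
  have w3 : ((r2 * K + r1) * K + r0) * K + b1 < K ^ 4 := by rw [pow_succ]; exact mul_add_lt w2 e1
  have w4 : (((r2 * K + r1) * K + r0) * K + b1) * K + b0 < K ^ 5 := by
    rw [pow_succ]; exact mul_add_lt w3 e0
  have p1 : K ≤ K ^ 4 := Nat.le_self_pow (by norm_num) K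
  have p2 : K ^ 2 ≤ K ^ 4 := Nat.pow_le_pow_right hK0 (by norm_num)
  have p3 : K ^ 3 ≤ K ^ 4 := Nat.pow_le_pow_right hK0 (by norm_num)
  have p4 : K ^ 4 ≤ K ^ 5 := Nat.pow_le_pow_right hK0 (by norm_num)
  have hquot := ht.quot _ w4
  have hβ2 : b1 * K + b0 < K ^ 2 := by rw [pow_two]; exact mul_add_lt e1 e0
  have hsplit : (((r2 * K + r1) * K + r0) * K + b1) * K + b0 =
      K ^ 2 * ((r2 * K + r1) * K + r0) + (b1 * K + b0) := by ring
  rw [hsplit, Nat.mul_add_div (by positivity), Nat.mul_add_mod, Nat.div_eq_of_lt hβ2,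
    Nat.mod_eq_of_lt hβ2, add_zero, ← hsplit] at hquot
  generalize ((r2 * K + r1) * K + r0) / (b1 * K + b0 + 1) = q at *
  simp only [divEst, wp, St.set_same, St.set_ne, Function.update_self, ne_eq, reduceCtorEq,
    not_false_eq_true, hr2, hr1, hr0, hb1, hb0, ht.shift r2 (by omega), ht.shift _ (w1.trans_le p2),
    ht.shift _ (w2.trans_le p3), ht.shift _ w3, hquot]
  refine ⟨by omega, by omega, by omega, by omega, ?_, hqK, hle, hlt⟩
  constructor
  · intro t ht
    have : t ≠ .wrk ∧ t ≠ .mlt := by simpa using ht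
    simp [this]
  · rfl

/-- The estimate is the quotient digit or one less. So the first subtraction always succeeds, and
the second, with multiplier `1`, succeeds exactly when a correction is due. -/
theorem wp_divStep {m s D b r : ℕ} {st : St} (hK : 2 ≤ K) (hV : 2 * K ^ 5 ≤ V)
    (ht : Tables K st.σ) (hb : Divisor K D b st.σ) (hm : 1 ≤ m) (hD : s + m + 2 ≤ D)
    (hbl : K ^ m ≤ b) (hbu : b < K ^ (m + 1)) (hQ : st.σ .quo s = 0)
    (hR : Digits K D (st.σ .rem)) (hr : val K (st.σ .rem) D = r) (hrb : r < K * (b * K ^ s)) :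
    wp V N I (divStep D m s) (fun st' =>
      Frame (.mlt :: trySubCls) st st' ∧ Digits K D (st'.σ .rem) ∧
      val K (st'.σ .rem) D = r % (b * K ^ s) ∧
      st'.σ .quo = Function.update (st.σ .quo) s (r / (b * K ^ s))) st := by
  have hK0 : 0 < K := by omega
  have hbs : b * K ^ s < K ^ D := by
    calc b * K ^ s < K ^ (m + 1) * K ^ s := by gcongr
      _ = K ^ (s + m + 1) := by rw [← pow_add]; congr 1; omega
      _ ≤ K ^ D := Nat.pow_le_pow_right hK0 (by omega)
  have hbs0 : 0 < b * K ^ s := Nat.mul_pos ((Nat.pow_pos hK0).trans_le hbl) (Nat.pow_pos hK0)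
  refine wp_seq (wp_divEst hK hV ht hb hm hD hbl hbu hR hr hrb) ?_
  rintro s₁ ⟨hF₁, hqK, hle, hlt⟩
  generalize hq : s₁.σ .mlt 0 = q at *
  have hrem₁ := hF₁.1 .rem (by decide)
  have hquo₁ := hF₁.1 .quo (by decide)
  refine wp_seq (wp_trySub hK hV (ht.frame hF₁ (by decide)) (hb.frame hF₁ (by decide) (by decide))
    (by omega) hbs hq hqK (by rw [hquo₁]; omega) (hrem₁ ▸ hR) (hrem₁ ▸ hr)) ?_
  rintro s₂ ⟨hF₂, hR₂, h₂⟩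
  rw [if_pos hle, hquo₁, hQ, zero_add] at h₂
  have hF₂' := (hF₁.weaken (l' := .mlt :: trySubCls) (by decide)).trans (hF₂.weaken (by decide))
  have hF₃ := hF₂'.set (x := (.mlt, 0)) (v := 1) (by decide)
  have hrem₃ : (s₂.set (.mlt, 0) 1).σ .rem = s₂.σ .rem := St.set_ne _ _ _ (by decide)
  have hquo₃ : (s₂.set (.mlt, 0) 1).σ .quo = s₂.σ .quo := St.set_ne _ _ _ (by decide)
  have hq₃ : (s₂.set (.mlt, 0) 1).σ .mlt 0 = 1 := by simp
  change wp V N I (trySub D s) _ (s₂.set (.mlt, 0) 1)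
  generalize s₂.set (.mlt, 0) 1 = s₃ at *
  refine wp_mono (wp_trySub hK hV (ht.frame hF₃ (by decide)) (hb.frame hF₃ (by decide) (by decide))
    (by omega) hbs hq₃ (by omega) (by rw [hquo₃, h₂.2, Function.update_self]; omega)
    (hrem₃ ▸ hR₂) (hrem₃ ▸ h₂.1)) ?_
  rintro s₄ ⟨hF₄, hR₄, h₄⟩
  refine ⟨hF₃.trans (hF₄.weaken (by decide)), hR₄, ?_⟩
  rw [hquo₃, h₂.2, one_mul, Function.update_self, Function.update_idem] at h₄
  have hdm : ∀ u, u * (b * K ^ s) ≤ r → r - u * (b * K ^ s) < b * K ^ s →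
      r % (b * K ^ s) = r - u * (b * K ^ s) ∧ r / (b * K ^ s) = u := by
    intro u h1 h2
    have h3 : r = (b * K ^ s) * u + (r - u * (b * K ^ s)) := by rw [mul_comm _ u]; omega
    constructor
    · rw [h3, Nat.mul_add_mod, Nat.mod_eq_of_lt h2, ← h3]
    · rw [h3, Nat.mul_add_div hbs0, Nat.div_eq_of_lt h2, add_zero]
  rw [add_mul] at hlt
  split_ifs at h₄ with hcase
  · obtain ⟨h5, h6⟩ := hdm (q + 1) (by rw [add_mul]; omega) (by rw [add_mul]; omega)
    rw [h5, h6, h₄.1, h₄.2, add_mul, one_mul]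
    exact ⟨by omega, rfl⟩
  · obtain ⟨h5, h6⟩ := hdm q hle (by omega)
    rw [h5, h6]
    exact h₄

/-- The long division by a divisor with the leading digit at position `m`. -/
def divLead (D m : ℕ) : Cmd := repDown (divStep D m) (D - 1 - m)

/-- The invariant is `quo * b + rem = a` with `rem < b * K ^ k` and zero quotient digits below
position `k`. It holds for `k = D - 1 - m` because `a < K ^ (D - 1)` and `K ^ m ≤ b`, and for `k =
0` it characterises quotient and remainder. Starting there also keeps the position `s + m + 1` read
by the estimate inside the array. -/
theorem wp_divLead {m D a b : ℕ} {st : St} (hK : 2 ≤ K) (hV : 2 * K ^ 5 ≤ V)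
    (ht : Tables K st.σ) (hb : Divisor K D b st.σ) (hm : 1 ≤ m) (hD : m + 1 ≤ D)
    (hbl : K ^ m ≤ b) (hbu : b < K ^ (m + 1)) (hQ : ∀ i < D, st.σ .quo i = 0)
    (hR : Digits K D (st.σ .rem)) (hr : val K (st.σ .rem) D = a) (ha : a < K ^ (D - 1)) :
    wp V N I (divLead D m) (fun st' =>
      Frame (.mlt :: trySubCls) st st' ∧ Digits K D (st'.σ .rem) ∧
      val K (st'.σ .rem) D = a % b ∧ Digits K D (st'.σ .quo) ∧
      val K (st'.σ .quo) D = a / b) st := by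
  have hK0 : 0 < K := by omega
  have hb0 : 0 < b := (Nat.pow_pos hK0).trans_le hbl
  refine wp_mono (wp_repDown (V := V) (N := N) (I := I) (fun k st' =>
      Frame (.mlt :: trySubCls) st st' ∧ Digits K D (st'.σ .rem) ∧
      val K (st'.σ .rem) D < b * K ^ k ∧ Digits K D (st'.σ .quo) ∧
      (∀ i < k, st'.σ .quo i = 0) ∧
      val K (st'.σ .quo) D * b + val K (st'.σ .rem) D = a) (n := D - 1 - m) ?_ ?_) ?_
  · refine ⟨.refl, hR, ?_, fun i hi => by rw [hQ i hi]; omega, fun i hi => hQ i (by omega), ?_⟩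
    · rw [hr]
      calc a < K ^ (D - 1) := ha
        _ = K ^ m * K ^ (D - 1 - m) := by rw [← pow_add]; congr 1; omega
        _ ≤ _ := by gcongr
    · rw [val_eq_zero hQ, hr]; simp
  · rintro k hk s₁ ⟨hF, hR₁, hlt, hQ₁, hQ0, he⟩
    rw [pow_succ', mul_left_comm] at hlt
    refine wp_mono (wp_divStep hK hV (ht.frame hF (by decide)) (hb.frame hF (by decide) (by decide))
      hm (by omega) hbl hbu (hQ0 k (by omega)) hR₁ rfl hlt) ?_
    rintro s₂ ⟨hF₂, hR₂, hr₂, hq₂⟩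
    have hbk : 0 < b * K ^ k := Nat.mul_pos hb0 (Nat.pow_pos hK0)
    have hdK : val K (s₁.σ .rem) D / (b * K ^ k) < K := by
      rw [Nat.div_lt_iff_lt_mul hbk]; exact hlt
    refine ⟨hF.trans hF₂, hR₂, by rw [hr₂]; exact Nat.mod_lt _ hbk, ?_, ?_, ?_⟩
    · intro i hi
      rw [hq₂, Function.update_apply]
      split_ifs
      exacts [hdK, hQ₁ i hi]
    · intro i hi
      rw [hq₂, Function.update_of_ne (by omega)]
      exact hQ0 i (by omega)
    · have hval : val K (s₂.σ .quo) D =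
          val K (s₁.σ .quo) D + val K (s₁.σ .rem) D / (b * K ^ k) * K ^ k := by
        rw [hq₂, val_update (by omega) (hQ0 k (by omega))]
      rw [hval, hr₂, ← he]
      conv_rhs => rw [← Nat.div_add_mod (val K (s₁.σ .rem) D) (b * K ^ k)]
      ring
  · rintro s' ⟨hF, hR', hlt, hQ', -, he⟩
    rw [pow_zero, mul_one] at hlt
    refine ⟨hF, hR', ?_, hQ', ?_⟩
    · rw [← he, mul_comm, Nat.mul_add_mod, Nat.mod_eq_of_lt hlt]
    · rw [← he, mul_comm, Nat.mul_add_div hb0, Nat.div_eq_of_lt hlt, add_zero]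

/-- Long division, where the leading digit of the divisor is to be found at a position at
most `m`. -/
def divCases (D : ℕ) : ℕ → Cmd
  | 0 => .skip
  | m + 1 => .ite (.dvs, m + 1) (divLead D (m + 1)) (divCases D m)

/-- Replace `rem` by its remainder modulo `dvs`; the quotient goes to `quo`. -/
def divMod (D : ℕ) : Cmd :=
  clear .quo D ;; rep (fun i => .look (.compl, i) .tCompl (.dvs, i)) D ;; divCases D (D - 1)

/-- The classes changed by `divMod`. -/
def divModCls : List Cls := .compl :: .mlt :: trySubCls

/-- The digit positions used by the long division are fixed in the program, so there is one copy for
each position of the leading divisor digit, selected by testing the digits from the top. Since `K ≤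
b`, a nonzero digit is found at a position at least `1`, and the final `skip` is never reached. -/
theorem wp_divMod {D a b : ℕ} {st : St} (hK : 2 ≤ K) (hV : 2 * K ^ 5 ≤ V)
    (ht : Tables K st.σ) (hB : Digits K D (st.σ .dvs)) (hb : val K (st.σ .dvs) D = b)
    (hKb : K ≤ b) (hR : Digits K D (st.σ .rem)) (hr : val K (st.σ .rem) D = a)
    (ha : a < K ^ (D - 1)) :
    wp V N I (divMod D) (fun st' =>
      Frame divModCls st st' ∧ Digits K D (st'.σ .rem) ∧
      val K (st'.σ .rem) D = a % b ∧ Digits K D (st'.σ .quo) ∧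
      val K (st'.σ .quo) D = a / b) st := by
  have hK0 : 0 < K := by omega
  refine wp_clear fun s₁ hF₁ h₁ => wp_fill (t := .compl)
    (g := fun i => K - 1 - st.σ .dvs i) ?_ ?_
  · intro i hi s' hs' R hRR
    have hF := (hF₁.weaken (l' := [.quo, .compl]) (by decide)).trans (hs'.weaken (by decide))
    simp only [wp]
    rw [(ht.frame hF (by decide)).compl _ (by rw [hF.1 _ (by decide)]; exact hB i hi),
      hF.1 _ (by decide)]
    exact hRR
  · intro s₂ hF₂ h₂
    have hF := (hF₁.weaken (l' := [.quo, .compl]) (by decide)).trans (hF₂.weaken (by decide))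
    have hrem : s₂.σ .rem = st.σ .rem := hF.1 _ (by decide)
    have hdvs : s₂.σ .dvs = st.σ .dvs := hF.1 _ (by decide)
    have hquo : s₂.σ .quo = s₁.σ .quo := hF₂.1 _ (by decide)
    have hdiv : Divisor K D b s₂.σ := ⟨hdvs ▸ hB, hdvs ▸ hb, by rw [hdvs]; exact h₂⟩
    have main : ∀ m, m + 1 ≤ D → b < K ^ (m + 1) → wp V N I (divCases D m) (fun st' =>
        Frame (.mlt :: trySubCls) s₂ st' ∧ Digits K D (st'.σ .rem) ∧
        val K (st'.σ .rem) D = a % b ∧ Digits K D (st'.σ .quo) ∧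
        val K (st'.σ .quo) D = a / b) s₂ := by
      intro m
      induction m with
      | zero => intro _ h; rw [zero_add, pow_one] at h; omega
      | succ m ih =>
        intro hm hbm
        have hv : b = val K (st.σ .dvs) (m + 1) + st.σ .dvs (m + 1) * K ^ (m + 1) := by
          rw [← val_succ, val_eq_of_lt hK0 hm (hb ▸ hbm), hb]
        refine ⟨fun h => ?_, fun h => ?_⟩
        · change s₂.σ .dvs (m + 1) ≠ 0 at h
          rw [hdvs] at h
          refine wp_divLead hK hV (ht.frame hF (by decide)) hdiv (by omega) hm ?_ hbm
            (by rw [hquo]; exact h₁) (hrem ▸ hR) (hrem ▸ hr) ha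
          have := Nat.mul_le_mul_right (K ^ (m + 1)) (Nat.one_le_iff_ne_zero.2 h)
          omega
        · rw [hdvs] at h
          refine ih (by omega) ?_
          rw [hv]
          simp only [h, zero_mul, add_zero]
          exact (hB.mono (by omega)).val_lt
    have hD : 1 ≤ D := by
      by_contra h
      obtain rfl : D = 0 := by omega
      simp at hb; omega
    refine wp_mono (main (D - 1) (by omega) ?_) ?_
    · rw [Nat.sub_add_cancel hD, ← hb]; exact hB.val_lt
    · rintro s' ⟨h, h'⟩
      exact ⟨(hF.weaken (by decide)).trans (h.weaken (by decide)), h'⟩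

end Query

/-! ### Conversion between bases and the division program -/

/-- The five digits of `wrk` in base `K` go to the array `t`. -/
def toDigits (t : Cls) : Cmd :=
  rep (fun i => .look (t, i) .tMod (.wrk, 0) ;; .look (.wrk, 0) .tDiv (.wrk, 0)) 5

/-- Multiply `acc` by `N` and add the result to `tmp`. -/
def mulBase (D : ℕ) : Cmd :=
  rep (fun j => .addc (.mlt, 0) (.base, j) 0 ;; .const (.car, 0) 0 ;; addmul .acc j (D - j)) 5

/-- Read the number with the `d` base `N` digits in the input registers from `o` on. -/
def readNum (D d o : ℕ) : Cmd :=
  clear .acc D ;; repDown (fun i => .inp (.wrk, 0) (o + i) ;; clear .tmp D ;; toDigits .tmp ;;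
    mulBase D ;; copy .acc .tmp D) d

/-- Output `rem / K` if this is less than `K ^ 5`. -/
def outDigit : Cmd :=
  .const (.wrk, 0) 0 ;; repDown (fun i => .look (.wrk, 0) .tShift (.wrk, 0) ;;
    .add (.wrk, 0) (.wrk, 0) (.rem, i + 1)) 5 ;; .out (.wrk, 0)

/-- Output the `d` base `N` digits of `rem / K`, given `K * N` in `dvs`. -/
def outNum (D d : ℕ) : Cmd :=
  rep (fun _ => divMod D ;; outDigit ;; copyShift .rem .quo D) d

/-- The number `N` goes to `acc`. -/
def loadBase (D : ℕ) : Cmd :=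
  rep (fun i => if i < 5 then .addc (.acc, i) (.base, i) 0 else .const (.acc, i) 0) D

/-- The division of two numbers with `d` digits in base `N`, using `D` digits in base `K`. -/
def divide (D d : ℕ) : Cmd :=
  .getN (.wrk, 0) ;; toDigits .base ;;
  readNum D d 0 ;; copyShift .rem .acc D ;; readNum D d d ;; copyShift .dvs .acc D ;;
  divMod D ;; copy .sav .rem D ;; copyShift .rem .quo D ;;
  loadBase D ;; copyShift .dvs .acc D ;;
  outNum D d ;; copy .rem .sav D ;; outNum D d

section Query

variable {V N K : ℕ} {I : ℕ → ℕ}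

theorem le_pow_five (K : ℕ) : K ≤ K ^ 5 := Nat.le_self_pow (by norm_num) K

theorem wp_toDigits {t : Cls} {x : ℕ} {st : St} {Q : St → Prop} (ht : Tables K st.σ)
    (htt : t ∉ tableCls) (htw : t ≠ .wrk) (hw : st.σ .wrk 0 = x) (hx : x < K ^ 5)
    (hQ : ∀ s', Frame [t, .wrk] st s' → (∀ i < 5, s'.σ t i = x / K ^ i % K) →
      (∀ i, 5 ≤ i → s'.σ t i = st.σ t i) → Q s') :
    wp V N I (toDigits t) Q st := by
  have htm : t ∉ [Cls.tDiv, .tMod, .tMul, .tQuot, .tShift, .tCompl] := htt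
  simp only [List.mem_cons, not_or] at htm
  refine wp_mono (wp_rep (fun k s' => Frame [t, .wrk] st s' ∧ s'.σ .wrk 0 = x / K ^ k ∧
    (∀ i < k, s'.σ t i = x / K ^ i % K) ∧ (∀ i, k ≤ i → s'.σ t i = st.σ t i))
    ⟨.refl, by simpa using hw, by simp, by simp⟩ ?_) fun s' h => hQ s' h.1 h.2.2.1 h.2.2.2
  rintro k hk s₁ ⟨hF, hw₁, h₁, h₂⟩
  have ht₁ : Tables K s₁.σ := ht.frame hF fun u hu => by
    simp only [List.mem_cons, List.not_mem_nil, or_false, not_or]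
    refine ⟨?_, ?_⟩
    · rintro rfl; exact htt hu
    · rintro rfl; revert hu; decide
  have hlt : x / K ^ k < K ^ 5 := (Nat.div_le_self _ _).trans_lt hx
  have hmod := ht₁.mod _ hlt
  have hdiv := ht₁.div _ hlt
  simp only [wp, St.set_same, St.set_ne _ _ _ htw.symm, hw₁, St.set_ne _ _ _ (Ne.symm htm.1),
    hmod, hdiv, St.set_ne _ _ _ htw, Function.update_self]
  refine ⟨(hF.set (by simp)).set (by simp), ?_, ?_, ?_⟩
  · rw [Nat.div_div_eq_div_mul, pow_succ]
  · intro i hi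
    rw [Function.update_apply]
    split_ifs with h
    · rw [h]
    · exact h₁ i (by omega)
  · intro i hi
    rw [Function.update_of_ne (by omega)]
    exact h₂ i (by omega)

/-- `base` holds the digits of `N` in base `K`. -/
def BaseDigits (K N : ℕ) (σ : Cls → ℕ → ℕ) : Prop := ∀ i < 5, σ .base i = N / K ^ i % K

/-- Because `h < K ^ (D - 5)`, each of the five partial products needs only the first `D - k` digits
of `acc`. The total is below `K ^ D`, so no partial product leaves a carry. -/
theorem wp_mulBase {D x h : ℕ} {st : St} (hK : 2 ≤ K) (hV : 2 * K ^ 5 ≤ V) (hN : N < K ^ 5)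
    (ht : Tables K st.σ) (hB : BaseDigits K N st.σ) (hA : Digits K D (st.σ .acc))
    (hh : val K (st.σ .acc) D = h) (hD : 5 ≤ D) (hhD : h < K ^ (D - 5))
    (hT : Digits K D (st.σ .tmp)) (hx : val K (st.σ .tmp) D = x) (hlt : N * h + x < K ^ D) :
    wp V N I (mulBase D) (fun st' => Frame [.tmp, .wrk, .car, .mltK, .mlt] st st' ∧
      Digits K D (st'.σ .tmp) ∧ val K (st'.σ .tmp) D = N * h + x) st := by
  have hK0 : 0 < K := by omega
  have hbd : ∀ i < 5, st.σ .base i < K := fun i hi => by rw [hB i hi]; exact Nat.mod_lt _ hK0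
  have hbv : val K (st.σ .base) 5 = N := by
    rw [val_congr hB, val_digits hN]
  refine wp_mono (wp_rep (fun k st' => Frame [.tmp, .wrk, .car, .mltK, .mlt] st st' ∧
    Digits K D (st'.σ .tmp) ∧ val K (st'.σ .tmp) D = val K (st.σ .base) k * h + x)
    ⟨.refl, hT, by simpa using hx⟩ ?_) fun s' h' => by rwa [hbv] at h'
  rintro k hk s₁ ⟨hF, hT₁, hv₁⟩
  have hb₁ : s₁.σ .base = st.σ .base := hF.1 _ (by decide)
  have hbk := hbd k hk
  have hK5 := le_pow_five K
  refine ⟨by change s₁.σ .base k + 0 ≤ V; rw [hb₁]; omega, ?_⟩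
  simp only [hb₁, add_zero]
  have hF₂ := (hF.set (x := (.mlt, 0)) (v := st.σ .base k) (by decide)).set (x := (.car, 0))
    (v := 0) (by decide)
  have hT₂ : ((s₁.set (.mlt, 0) (st.σ .base k)).set (.car, 0) 0).σ .tmp = s₁.σ .tmp := by simp
  have hm₂ : ((s₁.set (.mlt, 0) (st.σ .base k)).set (.car, 0) 0).σ .mlt 0 = st.σ .base k := by simp
  have hc₂ : ((s₁.set (.mlt, 0) (st.σ .base k)).set (.car, 0) 0).σ .car 0 = 0 := by simp
  change wp V N I (addmul .acc k (D - k)) _ ((s₁.set (.mlt, 0) (st.σ .base k)).set (.car, 0) 0)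
  generalize (s₁.set (.mlt, 0) (st.σ .base k)).set (.car, 0) 0 = s₂ at *
  have hA₂ : s₂.σ .acc = st.σ .acc := hF₂.1 _ (by decide)
  refine wp_mono (wp_addmul (X := .acc) (D := D) hK hV (by decide) (by omega)
    (ht.frame hF₂ (by decide)) (by omega) (by omega) (hT₂ ▸ hT₁)
    (hA₂ ▸ hA.mono (Nat.sub_le _ _))) ?_
  rintro s₃ ⟨hF₃, hT₃, -, hv⟩
  have hacc : val K (st.σ .acc) (D - k) = h := by
    rw [← hh]
    refine val_eq_of_lt hK0 (Nat.sub_le _ _) ?_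
    rw [hh]
    exact hhD.trans_le (Nat.pow_le_pow_right hK0 (by omega))
  rw [Nat.add_sub_cancel' (by omega), hA₂, hacc, hT₂, hv₁, hm₂, hc₂] at hv
  have hv' : val K (s₃.σ .tmp) D + K ^ D * s₃.σ .car 0 = val K (st.σ .base) (k + 1) * h + x := by
    rw [hv, val_succ]; ring
  have hle : val K (st.σ .base) (k + 1) * h ≤ N * h := by
    gcongr
    rw [← hbv]
    exact val_mono (by omega)
  refine ⟨hF₂.trans (hF₃.weaken (by decide)), hT₃, ?_⟩
  have hc0 : s₃.σ .car 0 = 0 := by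
    by_contra h0
    have := Nat.mul_le_mul_left (K ^ D) (Nat.one_le_iff_ne_zero.2 h0)
    omega
  rw [← hv', hc0, mul_zero, add_zero]

/-- Horner's rule from the most significant digit. The invariant adds the `k` digits not yet read to
`N ^ k` times `acc`, giving `a`; hence intermediate values stay at most `a` and no carry is lost. -/
theorem wp_readNum {D d o a : ℕ} {st : St} (hK : 2 ≤ K) (hV : 2 * K ^ 5 ≤ V) (hN : N < K ^ 5)
    (hN0 : 1 ≤ N) (ht : Tables K st.σ) (hB : BaseDigits K N st.σ) (hD : 5 * d + 5 ≤ D)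
    (ha : a < N ^ d) (hI : ∀ i < d, I (o + i) = a / N ^ i % N) :
    wp V N I (readNum D d o) (fun st' =>
      Frame [.tmp, .wrk, .car, .mltK, .mlt, .acc] st st' ∧
      Digits K D (st'.σ .acc) ∧ val K (st'.σ .acc) D = a) st := by
  have hK0 : 0 < K := by omega
  have hK5 := le_pow_five K
  have haK : a < K ^ (5 * d) := by
    rw [pow_mul]
    exact ha.trans_le (Nat.pow_le_pow_left hN.le d)
  have haD : a < K ^ (D - 5) := haK.trans_le (Nat.pow_le_pow_right hK0 (by omega))
  refine wp_clear fun s₀ hF₀ h₀ => ?_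
  refine wp_mono (wp_repDown (fun k st' => Frame [.tmp, .wrk, .car, .mltK, .mlt, .acc] st st' ∧
    Digits K D (st'.σ .acc) ∧
    N ^ k * val K (st'.σ .acc) D + val N (fun i => a / N ^ i % N) k = a)
    ⟨hF₀.weaken (by decide), fun i hi => by rw [h₀ i hi]; omega, ?_⟩ ?_) ?_
  · rw [val_eq_zero h₀, val_digits ha]; ring
  · rintro k hk s₁ ⟨hF₁, hA₁, hv₁⟩
    have hx : I (o + k) < K ^ 5 := by
      rw [hI k hk]
      exact (Nat.mod_lt _ hN0).trans hN
    have hF₂ := hF₁.set (x := (.wrk, 0)) (v := I (o + k)) (by decide)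
    have hA₂ : (s₁.set (.wrk, 0) (I (o + k))).σ .acc = s₁.σ .acc := by simp
    have hw₂ : (s₁.set (.wrk, 0) (I (o + k))).σ .wrk 0 = I (o + k) := by simp
    simp only [wp]
    generalize s₁.set (.wrk, 0) (I (o + k)) = s₂ at *
    refine wp_clear fun s₃ hF₃ h₃ => ?_
    have hF₃' := hF₂.trans (hF₃.weaken (by decide))
    refine wp_toDigits (ht.frame hF₃' (by decide)) (by decide) (by decide)
      (by rw [hF₃.1 _ (by decide), hw₂]) hx fun s₄ hF₄ h₄ h₄' => ?_
    have hF₄' := hF₃'.trans (hF₄.weaken (by decide))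
    have hT₄ : Digits K D (s₄.σ .tmp) := fun i hi => by
      rcases lt_or_ge i 5 with h | h
      · rw [h₄ i h]; exact Nat.mod_lt _ hK0
      · rw [h₄' i h, h₃ i hi]; omega
    have hv₄ : val K (s₄.σ .tmp) D = I (o + k) := by
      rw [val_split (m := 5) (by omega), val_congr h₄, val_digits hx, val_eq_zero, mul_zero,
        add_zero]
      intro i hi
      rw [h₄' _ (by omega), h₃ _ (by omega)]
    have hA₄ : s₄.σ .acc = s₁.σ .acc := by
      rw [hF₄.1 _ (by decide), hF₃.1 _ (by decide), hA₂]
    have hv' : N ^ k * (N * val K (s₁.σ .acc) D + I (o + k)) +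
        val N (fun i => a / N ^ i % N) k = a := by
      rw [val_succ] at hv₁
      rw [hI k hk]
      conv_rhs => rw [← hv₁]
      ring
    have hle : N * val K (s₁.σ .acc) D + I (o + k) ≤ a :=
      (Nat.le_mul_of_pos_left _ (Nat.pow_pos (n := k) hN0)).trans (by omega)
    have hle' : val K (s₁.σ .acc) D ≤ a := by
      have := Nat.le_mul_of_pos_left (val K (s₁.σ .acc) D) hN0
      omega
    refine wp_mono (wp_mulBase hK hV hN (ht.frame hF₄' (by decide))
      (by rw [BaseDigits, hF₄'.1 _ (by decide)]; exact hB) (hA₄ ▸ hA₁)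
      rfl (by omega) (by rw [hA₄]; omega) hT₄ hv₄ (by
        rw [hA₄]
        exact (hle.trans_lt haD).trans_le (Nat.pow_le_pow_right hK0 (by omega)))) ?_
    rintro s₅ ⟨hF₅, hT₅, hv₅⟩
    refine wp_copy (by decide) (fun i hi => by have := hT₅ i hi; omega) fun s₆ hF₆ h₆ => ?_
    refine ⟨(hF₄'.trans (hF₅.weaken (by decide))).trans (hF₆.weaken (by decide)), ?_, ?_⟩
    · intro i hi
      rw [h₆ i hi]; exact hT₅ i hi
    · rw [val_congr h₆, hv₅, hA₄, hv']
  · rintro s' ⟨hF, hA, hv⟩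
    exact ⟨hF, hA, by simpa using hv⟩

/-- The lowest digit is a multiple of `K` and less than `K`, hence zero; this undoes the shift by
one position. -/
theorem val_eq_mul {D y : ℕ} {f : ℕ → ℕ} (hf : Digits K (D + 1) f) (hK : 0 < K)
    (hv : val K f (D + 1) = K * y) : val K (fun i => f (i + 1)) D = y := by
  rw [val_succ'] at hv
  have h0 := hf 0 (by omega)
  have h1 : f 0 = 0 := by
    have h2 : K ∣ f 0 := (Nat.dvd_add_left (Dvd.intro _ rfl)).1 (hv ▸ Dvd.intro _ rfl)
    exact Nat.eq_zero_of_dvd_of_lt h2 h0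
  rw [h1, zero_add] at hv
  exact Nat.eq_of_mul_eq_mul_left hK hv

theorem wp_outDigit {D y : ℕ} {st : St} (hK : 2 ≤ K) (hV : 2 * K ^ 5 ≤ V)
    (ht : Tables K st.σ) (hD : 6 ≤ D) (hR : Digits K D (st.σ .rem))
    (hv : val K (st.σ .rem) D = K * y) (hy : y < K ^ 5) :
    wp V N I outDigit (fun st' => (∀ t, t ≠ .wrk → st'.σ t = st.σ t) ∧ st'.out = st.out ++ [y])
      st := by
  have hK0 : 0 < K := by omega
  obtain ⟨D, rfl⟩ : ∃ k, D = k + 1 := ⟨D - 1, by omega⟩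
  have hv' := val_eq_mul hR hK0 hv
  have hv5 : val K (fun i => st.σ .rem (i + 1)) 5 = y := by
    rw [← hv']; exact val_eq_of_lt hK0 (by omega) (hv' ▸ hy)
  refine wp_cons (wp_seq (wp_repDown (n := 5) (fun k s' => Frame [.wrk] st s' ∧
    K ^ k * s'.σ .wrk 0 + val K (fun i => st.σ .rem (i + 1)) k = y)
    ⟨Frame.refl.set (by decide), by simp [hv5]⟩ ?_) ?_)
  · rintro k hk s₁ ⟨hF, h₁⟩
    have hrem := hF.1 .rem (by decide)
    have hd := hR (k + 1) (by omega)
    generalize hw : s₁.σ .wrk 0 = w at *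
    -- Since `y < K ^ 5`, the prefix before each shift has at most four digits, which is the range
    -- of `tShift`.
    have hw4 : w < K ^ 4 := by
      by_contra h
      have h2 : K * K ^ 4 ≤ K ^ (k + 1) * w :=
        Nat.mul_le_mul (Nat.le_self_pow (by omega) K) (not_lt.1 h)
      have h3 : K ^ 5 = K * K ^ 4 := pow_succ' K 4
      omega
    have hlt : w * K + st.σ .rem (k + 1) < K ^ 5 := by
      rw [pow_succ]; exact mul_add_lt hw4 hd
    have hs := (ht.frame hF (by decide)).shift w hw4
    simp only [wp, St.set_same, ne_eq, reduceCtorEq, not_false_eq_true, St.set_ne, hw, hs,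
      Function.update_self, hrem]
    refine ⟨by omega, (hF.set (by decide)).set (by decide), ?_⟩
    rw [← h₁, val_succ]
    ring
  · rintro s₁ ⟨hF, h₁⟩
    simp only [pow_zero, one_mul, val_zero, add_zero] at h₁
    exact ⟨fun t ht => hF.1 t (by simpa using ht), by simp [h₁, hF.2]⟩

theorem wp_copyShift_val {t u : Cls} {D y : ℕ} {st : St} {Q : St → Prop} (htu : u ≠ t)
    (hK : 2 ≤ K) (hV : 2 * K ^ 5 ≤ V) (hu : Digits K D (st.σ u)) (hv : val K (st.σ u) D = y)
    (hy : y < K ^ (D - 1))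
    (hQ : ∀ s', Frame [t] st s' → Digits K D (s'.σ t) → val K (s'.σ t) D = K * y → Q s') :
    wp V N I (copyShift t u D) Q st := by
  have hK5 := le_pow_five K
  refine wp_copyShift htu (fun i hi => by have := hu i hi; omega) fun s' hF h => hQ s' hF ?_ ?_
  · intro i hi
    rw [h i hi]
    split_ifs
    · omega
    · exact hu _ (by omega)
  · cases D with
    | zero => simp only [val_zero] at hv ⊢; rw [← hv, mul_zero]
    | succ D =>
      rw [val_congr h, val_succ']
      simp only [if_true, zero_add, Nat.succ_ne_zero, if_false, Nat.add_sub_cancel] at hy ⊢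
      rw [val_eq_of_lt (n := D + 1) (by omega) (by omega) (hv ▸ hy), hv]

/-- Dividing `K * y` by `K * N` leaves `K * (y % N)`, whose digits from position `1` on give the
output, and the quotient `y / N`, which is shifted to become the next dividend. -/
theorem wp_outNum {D d x : ℕ} {st : St} (hK : 2 ≤ K) (hV : 2 * K ^ 5 ≤ V) (hN : N < K ^ 5)
    (hN0 : 1 ≤ N) (ht : Tables K st.σ) (hD : 6 ≤ D) (hB : Digits K D (st.σ .dvs))
    (hb : val K (st.σ .dvs) D = K * N) (hR : Digits K D (st.σ .rem))
    (hr : val K (st.σ .rem) D = K * x) (hx : x < K ^ (D - 2)) :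
    wp V N I (outNum D d) (fun st' => (∀ t, t ∉ divModCls → st'.σ t = st.σ t) ∧
      st'.out = st.out ++ digitList N d x) st := by
  have hK0 : 0 < K := by omega
  have hp : K * K ^ (D - 2) = K ^ (D - 1) := by rw [← pow_succ']; congr 1; omega
  refine wp_mono (wp_rep (fun k st' => (∀ t, t ∉ divModCls → st'.σ t = st.σ t) ∧
    Digits K D (st'.σ .rem) ∧ val K (st'.σ .rem) D = K * (x / N ^ k) ∧
    st'.out = st.out ++ digitList N k x) ⟨by simp, hR, by simpa using hr, by simp [digitList]⟩
    ?_) fun s' h => ⟨h.1, h.2.2.2⟩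
  rintro k hk s₁ ⟨hF₁, hR₁, hr₁, ho₁⟩
  have ht₁ : Tables K s₁.σ := ht.frame (s' := ⟨s₁.σ, st.out⟩) (l := divModCls) ⟨hF₁,
    rfl⟩ (by decide)
  have hdvs₁ := hF₁ .dvs (by decide)
  have hxk : x / N ^ k < K ^ (D - 2) := (Nat.div_le_self _ _).trans_lt hx
  refine wp_seq (wp_divMod hK hV ht₁ (hdvs₁ ▸ hB) (hdvs₁ ▸ hb) (Nat.le_mul_of_pos_right K hN0)
    hR₁ hr₁ (by rw [← hp]; gcongr)) ?_
  rintro s₂ ⟨hF₂, hR₂, hr₂, hQ₂, hq₂⟩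
  rw [Nat.mul_mod_mul_left] at hr₂
  rw [Nat.mul_div_mul_left _ _ hK0, Nat.div_div_eq_div_mul, ← pow_succ] at hq₂
  refine wp_seq (wp_outDigit hK hV (ht₁.frame hF₂ (by decide)) hD hR₂ hr₂
    ((Nat.mod_lt _ hN0).trans hN)) ?_
  rintro s₃ ⟨hF₃, ho₃⟩
  have hq₃ := hF₃ .quo (by decide)
  refine wp_copyShift_val (by decide) hK hV (hq₃ ▸ hQ₂) (hq₃ ▸ hq₂) ?_ fun s₄ hF₄ hR₄ hr₄ => ?_
  · exact ((Nat.div_le_self _ _).trans_lt hx).trans_le (Nat.pow_le_pow_right hK0 (by omega))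
  · refine ⟨fun t ht => ?_, hR₄, hr₄, ?_⟩
    · have h1 : t ≠ .rem := by rintro rfl; exact ht (by decide)
      have h2 : t ≠ .wrk := by rintro rfl; exact ht (by decide)
      rw [hF₄.1 t (by simpa using h1), hF₃ t h2, hF₂.1 t ht, hF₁ t ht]
    · rw [hF₄.2, ho₃, hF₂.2, ho₁]
      simp [digitList, List.range_succ]

/-- Of the initial memory only the tables matter. Among the `D = 5 * d + 10` positions, `5 * d` hold
numbers below `N ^ d`; the others leave room for the shift by one position and for the digits of
`N`. -/
theorem wp_divide {D d a b : ℕ} {st : St} (hK : 2 ≤ K) (hV : 2 * K ^ 5 ≤ V) (hN : N < K ^ 5)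
    (hN0 : 1 ≤ N) (ht : Tables K st.σ) (hD : D = 5 * d + 10) (ha : a < N ^ d) (hb : b < N ^ d)
    (hb0 : 0 < b) (hIa : ∀ i < d, I i = a / N ^ i % N) (hIb : ∀ i < d, I (d + i) = b / N ^ i % N) :
    wp V N I (divide D d) (fun st' =>
      st'.out = st.out ++ (digitList N d (a / b) ++ digitList N d (a % b))) st := by
  have hK0 : 0 < K := by omega
  have hK5 := le_pow_five K
  have hdK : N ^ d ≤ K ^ (5 * d) := by
    rw [pow_mul]; exact Nat.pow_le_pow_left hN.le d
  have hdD : ∀ j, 5 * d ≤ j → N ^ d ≤ K ^ j := fun j hj =>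
    hdK.trans (Nat.pow_le_pow_right hK0 hj)
  have hp : K * K ^ (D - 2) = K ^ (D - 1) := by rw [← pow_succ']; congr 1; omega
  have hF₁ : Frame [.wrk] st (st.set (.wrk, 0) N) := Frame.refl.set (by decide)
  refine wp_cons (show wp V N I _ _ (st.set (.wrk, 0) N) from ?_)
  refine wp_cons <| wp_toDigits (x := N) (ht.frame hF₁ (by decide)) (by decide) (by decide)
    (by simp) hN
    fun s₂ hF₂ hB₂ _ => ?_
  have ht₂ := (ht.frame hF₁ (by decide)).frame hF₂ (by decide)
  have ho₂ : s₂.out = st.out := hF₂.2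
  refine wp_seq (wp_readNum hK hV hN hN0 ht₂ hB₂ (by omega) ha (by simpa using hIa)) ?_
  rintro s₃ ⟨hF₃, hA₃, ha₃⟩
  refine wp_cons <| wp_copyShift_val (by decide) hK hV hA₃ ha₃ (ha.trans_le (hdD _ (by omega)))
    fun s₄ hF₄ hR₄ hr₄ => ?_
  have hF₄' := (hF₃.weaken (l' := [.tmp, .wrk, .car, .mltK, .mlt, .acc, .rem, .dvs])
    (by decide)).trans (hF₄.weaken (by decide))
  refine wp_seq (wp_readNum hK hV hN hN0 (ht₂.frame hF₄' (by decide))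
    (by rw [BaseDigits, hF₄'.1 _ (by decide)]; exact hB₂) (by omega) hb hIb) ?_
  rintro s₅ ⟨hF₅, hA₅, hb₅⟩
  refine wp_cons <| wp_copyShift_val (by decide) hK hV hA₅ hb₅ (hb.trans_le (hdD _ (by omega)))
    fun s₆ hF₆ hB₆ hb₆ => ?_
  have hF₆' := (hF₄'.trans (hF₅.weaken (by decide))).trans (hF₆.weaken (by decide))
  have hr₆ : s₆.σ .rem = s₄.σ .rem := by rw [hF₆.1 _ (by decide), hF₅.1 _ (by decide)]
  refine wp_seq (wp_divMod hK hV (ht₂.frame hF₆' (by decide)) hB₆ hb₆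
    (Nat.le_mul_of_pos_right K hb0) (hr₆ ▸ hR₄) (hr₆ ▸ hr₄) (by
      rw [← hp]
      exact Nat.mul_lt_mul_of_pos_left (ha.trans_le (hdD _ (by omega))) hK0)) ?_
  rintro s₇ ⟨hF₇, hR₇, hr₇, hQ₇, hq₇⟩
  rw [Nat.mul_mod_mul_left] at hr₇
  rw [Nat.mul_div_mul_left _ _ hK0] at hq₇
  have hqN : a / b < N ^ d := (Nat.div_le_self _ _).trans_lt ha
  have hrN : a % b < N ^ d := (Nat.mod_le _ _).trans_lt ha
  -- The remainder is saved, because the output of the quotient reuses `rem`.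
  refine wp_cons <| wp_copy (by decide) (fun i hi => by have := hR₇ i hi; omega) fun s₈ hF₈ h₈ => ?_
  have hq₈ := hF₈.1 .quo (by decide)
  refine wp_cons <| wp_copyShift_val (by decide) hK hV (hq₈ ▸ hQ₇) (hq₈ ▸ hq₇)
    (hqN.trans_le (hdD _ (by omega))) fun s₉ hF₉ hR₉ hr₉ => ?_
  have hF₉' := ((hF₇.weaken (l' := .sav :: .acc :: .dvs :: divModCls) (by decide)).trans
    (hF₈.weaken (by decide))).trans (hF₉.weaken (by decide))
  have hbase : s₉.σ .base = s₂.σ .base := by rw [hF₉'.1 _ (by decide), hF₆'.1 _ (by decide)]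
  have hbd : ∀ i < 5, s₉.σ .base i < K := fun i hi => by
    rw [hbase, hB₂ i hi]; exact Nat.mod_lt _ hK0
  refine wp_cons <| wp_fill (t := .acc) (g := fun i => if i < 5 then s₉.σ .base i else 0)
    (fun i hi s' hs' R hR => ?_) fun u₁ hG₁ g₁ => ?_
  · split_ifs at hR ⊢ with h5
    · have := hbd i h5
      simp only [wp, hs'.1 .base (by decide), add_zero]
      exact ⟨by omega, hR⟩
    · exact hR
  have hA₁ : Digits K D (u₁.σ .acc) := fun i hi => by
    rw [g₁ i hi]
    split_ifs with h
    exacts [hbd i h, hK0]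
  have hN₁ : val K (u₁.σ .acc) D = N := by
    rw [val_split (m := 5) (by omega), val_congr (g := fun i => N / K ^ i % K), val_digits hN,
      val_eq_zero, mul_zero, add_zero]
    · intro i hi
      rw [g₁ _ (by omega), if_neg (by omega)]
    · intro i hi
      rw [g₁ _ (by omega), if_pos hi, hbase, hB₂ i hi]
  refine wp_cons <| wp_copyShift_val (by decide) hK hV hA₁ hN₁
    (hN.trans_le (Nat.pow_le_pow_right hK0 (by omega))) fun u₂ hG₂ hB₂ hb₂ => ?_
  have hG := (hF₉'.trans (hG₁.weaken (by decide))).trans (hG₂.weaken (by decide))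
  have htu := (ht₂.frame hF₆' (by decide)).frame hG (by decide)
  have hrem₂ : u₂.σ .rem = s₉.σ .rem := by rw [hG₂.1 _ (by decide), hG₁.1 _ (by decide)]
  have hsav₂ : ∀ i < D, u₂.σ .sav i = s₇.σ .rem i := by
    rw [hG₂.1 _ (by decide), hG₁.1 _ (by decide), hF₉.1 _ (by decide)]; exact h₈
  refine wp_seq (wp_outNum (d := d) hK hV hN hN0 htu (by omega) hB₂ hb₂ (hrem₂ ▸ hR₉)
    (hrem₂ ▸ hr₉) (hqN.trans_le (hdD _ (by omega)))) ?_
  rintro u₃ ⟨hG₃, ho₃⟩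
  have htu₃ : Tables K u₃.σ :=
    htu.frame (s' := ⟨u₃.σ, u₂.out⟩) (l := divModCls) ⟨hG₃, rfl⟩ (by decide)
  have hsav₃ := hG₃ .sav (by decide)
  have hdvs₃ := hG₃ .dvs (by decide)
  refine wp_cons <| wp_copy (by decide) (fun i hi => ?_) fun u₄ hG₄ g₄ => ?_
  · have := hR₇ i hi
    rw [hsav₃, hsav₂ i hi]
    omega
  have hrem₄ : ∀ i < D, u₄.σ .rem i = s₇.σ .rem i := fun i hi => by
    rw [g₄ i hi, hsav₃, hsav₂ i hi]
  have hdvs₄ : u₄.σ .dvs = u₂.σ .dvs := by rw [hG₄.1 _ (by decide), hdvs₃]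
  refine wp_mono (wp_outNum (d := d) hK hV hN hN0 (htu₃.frame hG₄ (by decide)) (by omega)
    (hdvs₄ ▸ hB₂) (hdvs₄ ▸ hb₂) (fun i hi => by rw [hrem₄ i hi]; exact hR₇ i hi)
    ((val_congr hrem₄).trans hr₇) (hrN.trans_le (hdD _ (by omega)))) ?_
  rintro u₅ ⟨-, ho₅⟩
  rw [ho₅, hG₄.2, ho₃, hG.2, hF₆'.2, ho₂, List.append_assoc]

end Query

/-! ### Counting loops and the search for the base -/

theorem St.get_set (s : St) (x y : Cell) (v : ℕ) :
    (s.set x v).σ y.1 y.2 = if y = x then v else s.σ y.1 y.2 := by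
  obtain ⟨t, i⟩ := x
  obtain ⟨u, j⟩ := y
  by_cases h : u = t
  · subst h; simp [Function.update_apply]
  · simp [h]

theorem wp.runs_le {V N : ℕ} {I : ℕ → ℕ} (hN : N ≤ V) (hI : ∀ j, I j ≤ V) {c : Cmd} {T : ℕ}
    {s : St} {Q : St → Prop} (hb : c.bound ≤ V) (hT : c.cost ≤ T) (h : wp V N I c Q s) :
    Runs V N I c T s Q :=
  (wp.runs hN hI hb h).mono hT fun _ => id

/-- For `i` from `0` to `n - 1` do `body`, with an auxiliary cell `f`. -/
def forLoop (i n f : Cell) (body : Cmd) : Cmd :=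
  .const i 0 ;; .eq f i n ;; .loop f (body ;; .addc i i 1 ;; .eq f i n)

section Precomputation

variable {V N : ℕ} {I : ℕ → ℕ}

/-- By `hset` the invariant is insensitive to the counter and the flag, so the increment and the
test preserve it. The proof is by induction on the number of remaining rounds; `130` covers the
increment, the test and the jumps. -/
theorem Runs.forLoop (hN : N ≤ V) (hI : ∀ j, I j ≤ V) {i n f : Cell} {body : Cmd} {T m : ℕ}
    (Inv : ℕ → St → Prop) {s : St} (hV : 3 * i.2 + n.2 + f.2 + 3 ≤ V) (hif : i ≠ f) (hnf : n ≠ f)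
    (hn : ∀ k s, Inv k s → s.σ n.1 n.2 = m)
    (hset : ∀ k s u w, Inv k s → Inv k ((s.set i u).set f w)) (h0 : Inv 0 s) (hmV : m ≤ V)
    (hb : ∀ k < m, ∀ s, Inv k s → s.σ i.1 i.2 = k →
      Runs V N I body T s fun s' => s'.σ i.1 i.2 = k ∧ Inv (k + 1) s') :
    Runs V N I (AddRAM.forLoop i n f body) (m * (T + 130) + 130) s (Inv m) := by
  have htest : ∀ k u s, Inv k s → ∀ w, w = (if (s.set i u).σ i.1 i.2 =
      (s.set i u).σ n.1 n.2 then 1 else 0) → Inv k ((s.set i u).set f w) ∧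
      ((s.set i u).set f w).σ i.1 i.2 = u ∧
      ((s.set i u).set f w).σ f.1 f.2 = (if u = m then 1 else 0) := by
    intro k u s hs w hw
    have h1 := hset k s u w hs
    have h2 := hn _ _ h1
    rw [St.get_set, if_neg hnf] at h2
    rw [h2, St.get_set, if_pos rfl] at hw
    refine ⟨h1, ?_, ?_⟩
    · rw [St.get_set, if_neg hif, St.get_set, if_pos rfl]
    · rw [St.get_set, if_pos rfl, hw]
  have key : ∀ r k, k + r = m → ∀ s, Inv k s → s.σ i.1 i.2 = k →
      s.σ f.1 f.2 = (if k = m then 1 else 0) →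
      Runs V N I (.loop f (body ;; .addc i i 1 ;; .eq f i n)) (r * (T + 130) + 3) s (Inv m) := by
    intro r
    induction r with
    | zero =>
      intro k hk s hs _ hf
      obtain rfl : k = m := by omega
      exact (Runs.loop_done (by omega) (by simp [hf]) hs).mono (by omega) fun _ => id
    | succ r ih =>
      intro k hk s hs hi hf
      rw [if_neg (by omega)] at hf
      refine (Runs.loop_step (T := T + 120) (T' := r * (T + 130) + 3) (by omega) hf ?_).mono
        (by rw [add_mul]; omega) fun _ => id
      refine (hb k (by omega) s hs hi).seq fun s' hs' => ?_
      refine wp.runs (c := .addc i i 1 ;; .eq f i n) hN hI (by simp only [Cmd.bound]; omega) ?_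
      simp only [wp, hs'.1]
      obtain ⟨h1, h2, h3⟩ := htest _ (k + 1) _ hs'.2 _ rfl
      exact ⟨by omega, ih (k + 1) (by omega) _ h1 h2 h3⟩
  refine (Runs.seq (T₁ := 60) (T₂ := 60 + (m * (T + 130) + 3))
    (wp.runs (c := .const i 0) (Q := fun s' => s' = s.set i 0) hN hI
      (by simp only [Cmd.bound]; omega) rfl) ?_).mono (by omega) fun _ => id
  rintro _ rfl
  refine (wp.runs (c := .eq f i n) (Q := fun s' => s' = (s.set i 0).set f (if
    (s.set i 0).σ i.1 i.2 =
      (s.set i 0).σ n.1 n.2 then 1 else 0)) hN hI (by simp only [Cmd.bound]; omega) rfl).seq ?_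
  rintro _ rfl
  obtain ⟨h1, h2, h3⟩ := htest 0 0 s h0 _ rfl
  exact key m 0 (by omega) _ h1 h2 (by rw [h3])

/-- `x ← 2 ^ j * x` -/
def dbl (x : Cell) (j : ℕ) : Cmd := rep (fun _ => .add x x x) j

/-- Find a base `K` for which `K ^ 5` is of the order of `N`, and compute its powers. -/
def findBase : Cmd :=
  (.const (.pre, 3) 2 ;; .const (.pre, 4) 4 ;; .const (.pre, 5) 8 ;; .const (.pre, 6) 16 ;;
    .const (.pre, 7) 32 ;; .getN (.pre, 1)) ;;
  forLoop (.pre, 0) (.pre, 1) (.pre, 2) (.addc (.pre, 8) (.pre, 0) 1 ;;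
    .eq (.pre, 8) (.pre, 8) (.pre, 7) ;;
    .ite (.pre, 8) (dbl (.pre, 3) 1 ;; dbl (.pre, 4) 2 ;; dbl (.pre, 5) 3 ;; dbl (.pre, 6) 4 ;;
      dbl (.pre, 7) 5) .skip)

/-- The powers of the base `K` are available. -/
structure Powers (K : ℕ) (s : St) : Prop where
  pow1 : s.σ .pre 3 = K
  pow2 : s.σ .pre 4 = K ^ 2
  pow3 : s.σ .pre 5 = K ^ 3
  pow4 : s.σ .pre 6 = K ^ 4
  pow5 : s.σ .pre 7 = K ^ 5

/-- Doubling `K` when the counter reaches `K ^ 5` restores `k < K ^ 5`, and the new fifth power is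
exactly `32` times the counter. The term `max k 1` accounts for the start with `K = 2` and `k = 0`.
The powers of `K` are updated by repeated doubling. -/
theorem runs_findBase (hN : N ≤ V) (hI : ∀ j, I j ≤ V) (hN0 : 1 ≤ N) (hV : 1000 + 32 * N ≤ V)
    (s : St) :
    Runs V N I findBase (N * 2000 + 1000) s fun s' =>
      ∃ K, 2 ≤ K ∧ N < K ^ 5 ∧ K ^ 5 ≤ 32 * N ∧ Powers K s' := by
  refine (Runs.seq (T₁ := 360) (T₂ := N * (1064 + 130) + 130) (wp.runs hN hI
    (Q := fun s' => s'.σ .pre 1 = N ∧ Powers 2 s')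
    (by simp only [Cmd.bound]; omega) ?_) fun s₁ hs₁ => ?_).mono (by omega) fun _ => id
  · simp only [wp]
    refine ⟨?_, ?_, ?_, ?_, ?_, ?_⟩ <;> simp
  · refine (Runs.forLoop hN hI (fun k s' => s'.σ .pre 1 = N ∧ ∃ K, 2 ≤ K ∧ k < K ^ 5 ∧
      K ^ 5 ≤ 32 * max k 1 ∧ Powers K s') (by dsimp only; omega) (by simp) (by simp) ?_ ?_ ?_ hN
      ?_).mono le_rfl ?_
    · exact fun k s hs => hs.1
    · rintro k s u w ⟨h1, K, h2, h3, h4, h5⟩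
      refine ⟨by simpa [Function.update_apply] using h1, K, h2, h3, h4, ?_⟩
      constructor <;> simp [h5.pow1, h5.pow2, h5.pow3, h5.pow4, h5.pow5]
    · exact ⟨hs₁.1, 2, le_rfl, by norm_num, by norm_num, hs₁.2⟩
    · rintro k hk s ⟨h1, K, h2, h3, h4, h5⟩ hi
      refine wp.runs_le hN hI (by simp [Cmd.bound, dbl, rep]; omega) (by simp [Cmd.cost, dbl,
        rep]) ?_
      have hm : max k 1 ≤ N := by omega
      have hp1 : K ≤ K ^ 5 := le_pow_five K
      have hp2 : K ^ 2 ≤ K ^ 5 := Nat.pow_le_pow_right (by omega) (by norm_num)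
      have hp3 : K ^ 3 ≤ K ^ 5 := Nat.pow_le_pow_right (by omega) (by norm_num)
      have hp4 : K ^ 4 ≤ K ^ 5 := Nat.pow_le_pow_right (by omega) (by norm_num)
      change s.σ .pre 0 = k at hi
      refine ⟨by change s.σ .pre 0 + 1 ≤ V; rw [hi]; omega, ?_⟩
      simp only [wp, St.set_same, Function.update_self, hi]
      by_cases hk1 : k + 1 = K ^ 5
      · have e1 : (2 * K) ^ 2 = 4 * K ^ 2 := by ring
        have e2 : (2 * K) ^ 3 = 8 * K ^ 3 := by ring
        have e3 : (2 * K) ^ 4 = 16 * K ^ 4 := by ring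
        have e4 : (2 * K) ^ 5 = 32 * K ^ 5 := by ring
        simp only [dbl, rep, wp, St.set_same, Function.update_apply, h5.pow1, h5.pow2, h5.pow3,
          h5.pow4, h5.pow5, hk1, hi]
        norm_num
        refine ⟨by omega, by omega, by omega, by omega, by omega, by omega, by omega, by omega,
          by omega, by omega, by omega, by omega, by omega, by omega, by omega, h1,
          2 * K, by omega, by omega, by omega, ?_⟩
        constructor <;> simp <;> omega
      · simp [h5.pow5, hk1, hi, h1]
        refine ⟨K, h2, by omega, by omega, ?_⟩
        constructor <;> simp [h5.pow1, h5.pow2, h5.pow3, h5.pow4, h5.pow5]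
    · rintro s' ⟨-, K, h2, h3, h4, h5⟩
      exact ⟨K, h2, h3, by omega, h5⟩

end Precomputation

/-! ### Filling the tables in linear time -/

/-- Fill the tables for one digit with the leading part `h` (in cell 10). -/
def rowBody : Cmd :=
  .put .tDiv (.pre, 9) (.pre, 10) ;; .put .tMod (.pre, 9) (.pre, 11) ;;
  .put .tMul (.pre, 9) (.pre, 13) ;; .add (.pre, 13) (.pre, 13) (.pre, 10) ;;
  .add (.pre, 8) (.pre, 10) (.pre, 11) ;; .addc (.pre, 8) (.pre, 8) 1 ;;
  .eq (.pre, 8) (.pre, 8) (.pre, 3) ;;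
  .ite (.pre, 8) (.put .tCompl (.pre, 10) (.pre, 11)) .skip ;;
  .addc (.pre, 9) (.pre, 9) 1

/-- Fill all tables except for `tQuot`. -/
def fillDigits : Cmd :=
  .const (.pre, 9) 0 ;; forLoop (.pre, 10) (.pre, 6) (.pre, 2) (
    (.put .tShift (.pre, 10) (.pre, 9) ;; .const (.pre, 13) 0) ;;
    forLoop (.pre, 11) (.pre, 3) (.pre, 12) rowBody)

/-- Fill the table `tQuot`. -/
def fillQuot : Cmd :=
  forLoop (.pre, 10) (.pre, 4) (.pre, 2) (
    (.addc (.pre, 9) (.pre, 10) 0 ;; .const (.pre, 13) 0 ;; .const (.pre, 14) 0) ;;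
    forLoop (.pre, 11) (.pre, 5) (.pre, 12) (
      .put .tQuot (.pre, 9) (.pre, 13) ;; .add (.pre, 9) (.pre, 9) (.pre, 4) ;;
      .addc (.pre, 14) (.pre, 14) 1 ;; .addc (.pre, 8) (.pre, 10) 1 ;;
      .eq (.pre, 8) (.pre, 8) (.pre, 14) ;;
      .ite (.pre, 8) (.const (.pre, 14) 0 ;; .addc (.pre, 13) (.pre, 13) 1) .skip))

/-- The state of the tables (without `tQuot`), when `v` entries are computed, `k` of them shifted,
and the complements in the next row up to column `j`. -/
structure Partial (K v k j : ℕ) (s : St) : Prop where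
  powers : Powers K s
  div : ∀ u < v, s.σ .tDiv u = u / K
  mod : ∀ u < v, s.σ .tMod u = u % K
  mul : ∀ u < v, s.σ .tMul u = (u / K) * (u % K)
  shift : ∀ u < k, s.σ .tShift u = u * K
  compl : ∀ u < K, (u + 1 < k ∨ u + 1 = k ∧ K - 1 - u < j) → s.σ .tCompl u = K - 1 - u

theorem Powers.set {K i v : ℕ} {s : St} (h : Powers K s) (hi : 8 ≤ i ∨ i < 3) :
    Powers K (s.set (.pre, i) v) := by
  constructor <;> rw [St.set_same, Function.update_of_ne (by omega)]
  exacts [h.pow1, h.pow2, h.pow3, h.pow4, h.pow5]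

theorem Powers.set_ne {K i v : ℕ} {t : Cls} {s : St} (h : Powers K s) (ht : Cls.pre ≠ t) :
    Powers K (s.set (t, i) v) := by
  constructor <;> rw [St.set_ne _ _ _ ht]
  exacts [h.pow1, h.pow2, h.pow3, h.pow4, h.pow5]

theorem Partial.set {K v k j i w : ℕ} {s : St} (h : Partial K v k j s) (hi : 8 ≤ i ∨ i < 3) :
    Partial K v k j (s.set (.pre, i) w) := by
  refine ⟨h.powers.set hi, ?_, ?_, ?_, ?_, ?_⟩ <;> rw [St.set_ne _ _ _ (by decide)]
  exacts [h.div, h.mod, h.mul, h.shift, h.compl]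

theorem forall_lt_succ_update {f g : ℕ → ℕ} {v : ℕ} (h : ∀ u < v, f u = g u) {w : ℕ}
    (hw : w = g v) : ∀ u < v + 1, Function.update f v w u = g u := by
  intro u hu
  rw [Function.update_apply]
  split_ifs with e
  · rw [hw, e]
  · exact h u (by omega)

section Precomputation

variable {V N K : ℕ} {I : ℕ → ℕ}

/-- The entry in row `k` and column `j` has the index `k * K + j`, so `k` and `j` are its quotient
and remainder; their product grows by `k` from column to column. The complement of `k` is the column
with `k + j + 1 = K`. -/
theorem wp_rowBody {k j : ℕ} {s : St} (hK : 2 ≤ K) (hV : 2 * K ^ 5 + 100 ≤ V) (hk : k < K ^ 4)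
    (hj : j < K) (hh : s.σ .pre 10 = k) (hl : s.σ .pre 11 = j) (hp : s.σ .pre 13 = k * j)
    (hv : s.σ .pre 9 = k * K + j) (h : Partial K (k * K + j) (k + 1) j s) :
    wp V N I rowBody (fun s' => s'.σ .pre 11 = j ∧ s'.σ .pre 10 = k ∧
      s'.σ .pre 13 = k * (j + 1) ∧ s'.σ .pre 9 = k * K + (j + 1) ∧
      Partial K (k * K + (j + 1)) (k + 1) (j + 1) s') s := by
  have hlt : k * K + j < K ^ 5 := by rw [pow_succ]; exact mul_add_lt hk hj
  have hkj : k * j ≤ k * K := Nat.mul_le_mul_left k hj.le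
  have hkK : k ≤ k * K := Nat.le_mul_of_pos_right k (by omega)
  have hK5 := le_pow_five K
  have hdiv : (k * K + j) / K = k := by
    rw [mul_comm, Nat.mul_add_div (by omega), Nat.div_eq_of_lt hj, add_zero]
  have hmod : (k * K + j) % K = j := by
    rw [mul_comm, Nat.mul_add_mod, Nat.mod_eq_of_lt hj]
  have main : ∀ s₁ : St, Powers K s₁ →
      s₁.σ .tDiv = Function.update (s.σ .tDiv) (k * K + j) k →
      s₁.σ .tMod = Function.update (s.σ .tMod) (k * K + j) j →
      s₁.σ .tMul = Function.update (s.σ .tMul) (k * K + j) (k * j) →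
      s₁.σ .tShift = s.σ .tShift →
      s₁.σ .tCompl = (if k + j + 1 = K then Function.update (s.σ .tCompl) k j else s.σ .tCompl) →
      Partial K (k * K + (j + 1)) (k + 1) (j + 1) s₁ := by
    intro s₁ h1 h2 h3 h4 h5 h6
    refine ⟨h1, ?_, ?_, ?_, by rw [h5]; exact h.shift, ?_⟩
    · rw [h2]; exact forall_lt_succ_update h.div hdiv.symm
    · rw [h3]; exact forall_lt_succ_update h.mod hmod.symm
    · rw [h4]
      exact forall_lt_succ_update (g := fun u => (u / K) * (u % K)) h.mul
        (by simp only [hdiv, hmod])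
    · intro u hu hu'
      rw [h6]
      split_ifs with he
      · rw [Function.update_apply]
        split_ifs with hku
        · omega
        · exact h.compl u hu (by omega)
      · exact h.compl u hu (by omega)
  simp [rowBody, wp, hh, hl, hp, hv, h.powers.pow1]
  have e1 : k * (j + 1) = k * j + k := by ring
  refine ⟨by omega, by omega, by omega, fun he => ⟨by omega, by omega, by omega, main _ ?_ ?_ ?_ ?_
    ?_ ?_⟩, fun he => ⟨by omega, by omega, by omega, main _ ?_ ?_ ?_ ?_ ?_ ?_⟩⟩
  case refine_1 | refine_7 =>
    constructor <;> simp [h.powers.pow1, h.powers.pow2, h.powers.pow3, h.powers.pow4, h.powers.pow5]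
  all_goals simp [he]

/-- Cell `9` counts the entries over all rows, so at the start of row `k` it contains `k * K`, the
entry needed in `tShift`. There are `K ^ 4` rows of `K` entries, each of constant cost. -/
theorem runs_fillDigits (hN : N ≤ V) (hI : ∀ j, I j ≤ V) (hK : 2 ≤ K)
    (hV : 2 * K ^ 5 + 1000 ≤ V) {s : St} (hs : Powers K s) :
    Runs V N I fillDigits (K ^ 5 * 2000 + 1000) s fun s' =>
      Partial K (K ^ 5) (K ^ 4) K s' := by
  have h45 : K ^ 4 ≤ K ^ 5 := Nat.pow_le_pow_right (by omega) (by norm_num)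
  have hK5 := le_pow_five K
  refine (Runs.seq (T₁ := 60) (T₂ := K ^ 4 * (120 + (K * (700 + 130) + 130) + 130) + 130)
    (wp.runs (c := .const (.pre, 9) 0) (Q := fun s' => s' = s.set (.pre,
      9) 0) hN hI (by simp only [Cmd.bound]; omega) rfl)
    ?_).mono ?_ fun _ => id
  · rintro _ rfl
    refine (Runs.forLoop hN hI (fun k s' => s'.σ .pre 9 = k * K ∧ Partial K (k * K) k K s')
      (by dsimp only; omega) (by simp) (by simp) ?_ ?_ ?_ (h45.trans (by omega)) ?_).mono le_rfl ?_
    · exact fun k s hs => hs.2.powers.pow4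
    · rintro k s u w ⟨h1, h2⟩
      exact ⟨by simpa using h1, (h2.set (by omega)).set (by omega)⟩
    · exact ⟨by simp, hs.set (by omega), by simp, by simp, by simp, by simp, by omega⟩
    · rintro k hk s ⟨h1, h2⟩ hi
      change s.σ .pre 10 = k at hi
      refine (wp.runs (Q := fun s' => s'.σ .pre 10 = k ∧ s'.σ .pre 13 = k * 0 ∧
        s'.σ .pre 9 = k * K + 0 ∧ Partial K (k * K + 0) (k + 1) 0 s') hN hI
        (by simp only [Cmd.bound]; omega) ?_).seq ?_
      · simp only [wp, hi, h1]
        refine ⟨by simp [hi], by simp, by simp [h1], Partial.set (by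
          refine ⟨h2.powers.set_ne (by decide), ?_, ?_, ?_, ?_, ?_⟩
          · simpa using h2.div
          · simpa using h2.mod
          · simpa using h2.mul
          · rw [St.set_same]
            exact forall_lt_succ_update (g := fun u => u * K) h2.shift rfl
          · intro u hu hu'
            rw [St.set_ne _ _ _ (by decide)]
            exact h2.compl u hu (by omega)) (by omega)⟩
      · intro s₁ hs₁
        refine (Runs.forLoop hN hI (fun j s' => s'.σ .pre 10 = k ∧ s'.σ .pre 13 = k * j ∧
          s'.σ .pre 9 = k * K + j ∧ Partial K (k * K + j) (k + 1) j s')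
          (by dsimp only; omega) (by simp) (by simp) ?_ ?_ hs₁ (by omega) ?_).mono le_rfl ?_
        · exact fun j s hs => hs.2.2.2.powers.pow1
        · rintro j s u w ⟨h1, h2, h3, h4⟩
          exact ⟨by simpa using h1, by simpa using h2, by simpa using h3,
            (h4.set (by omega)).set (by omega)⟩
        · rintro j hj s₂ ⟨h3, h4, h5, h6⟩ hi₂
          exact wp.runs_le hN hI (by simp [Cmd.bound, rowBody]; omega)
            (by simp [Cmd.cost, rowBody]) (wp_rowBody hK (by omega) hk hj h3 hi₂ h4 h5 h6)
        · rintro s₂ ⟨h3, -, h5, h6⟩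
          have e : (k + 1) * K = k * K + K := by ring
          refine ⟨h3, e ▸ h5, ?_⟩
          rw [e]
          exact h6
    · rintro s' ⟨-, h⟩
      rwa [← pow_succ] at h
  · have h1 : K ^ 4 * (120 + (K * (700 + 130) + 130) + 130) = K ^ 5 * 830 + K ^ 4 * 380 := by ring
    omega

/-- The columns `u % K ^ 2 < k` of the table `tQuot` are filled, and the next one up to row `j`. -/
def QuotPartial (K k j : ℕ) (f : ℕ → ℕ) : Prop :=
  ∀ u, (u % K ^ 2 < k ∧ u / K ^ 2 < K ^ 3 ∨ u % K ^ 2 = k ∧ u / K ^ 2 < j) →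
    f u = u / K ^ 2 / (u % K ^ 2 + 1)

theorem QuotPartial.update {k j q : ℕ} {f : ℕ → ℕ} (h : QuotPartial K k j f) (hk : k < K ^ 2)
    (hq : q = j / (k + 1)) :
    QuotPartial K k (j + 1) (Function.update f (K ^ 2 * j + k) q) := by
  intro u hu
  have hdm := Nat.div_add_mod u (K ^ 2)
  rw [Function.update_apply]
  split_ifs with he
  · rw [he, Nat.mul_add_div (by omega), Nat.mul_add_mod, Nat.div_eq_of_lt hk, Nat.mod_eq_of_lt hk,
      hq, add_zero]
  · refine h u ?_
    rcases hu with hu | ⟨h1, h2⟩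
    · exact .inl hu
    · refine .inr ⟨h1, ?_⟩
      rcases Nat.lt_succ_iff_lt_or_eq.1 h2 with h3 | h3
      · exact h3
      · rw [h1, h3] at hdm
        omega

/-- Quotient and remainder are updated by counting, with the remainder wrapping around at `k + 1`.
The condition has the form of the equality test in `fillQuot`. -/
theorem succ_div_mod (j k : ℕ) :
    if k + 1 = j % (k + 1) + 1 then (j + 1) / (k + 1) = j / (k + 1) + 1 ∧ (j + 1) % (k + 1) = 0
    else (j + 1) / (k + 1) = j / (k + 1) ∧ (j + 1) % (k + 1) = j % (k + 1) + 1 := by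
  have hdm := Nat.div_add_mod j (k + 1)
  have hlt := Nat.mod_lt j (show 0 < k + 1 by omega)
  split_ifs with h
  · have e : j + 1 = (k + 1) * (j / (k + 1) + 1) := by rw [mul_add]; omega
    constructor
    · conv_lhs => rw [e]
      rw [Nat.mul_div_cancel_left _ (Nat.succ_pos k)]
    · rw [e, Nat.mul_mod_right]
  · have e : j + 1 = (k + 1) * (j / (k + 1)) + (j % (k + 1) + 1) := by omega
    have hlt' : j % (k + 1) + 1 < k + 1 := by omega
    constructor
    · conv_lhs => rw [e]
      rw [Nat.mul_add_div (Nat.succ_pos k), Nat.div_eq_of_lt hlt', add_zero]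
    · conv_lhs => rw [e]
      rw [Nat.mul_add_mod, Nat.mod_eq_of_lt hlt']

/-- For a fixed column `k` the entries lie at distance `K ^ 2`, and the entry in row `j` is `j / (k
+ 1)`. The divisor is constant along a column, so counting replaces division. -/
theorem runs_fillQuot (hN : N ≤ V) (hI : ∀ j, I j ≤ V) (hK : 2 ≤ K)
    (hV : 2 * K ^ 5 + 1000 ≤ V) {s : St} (hs : Powers K s) :
    Runs V N I fillQuot (K ^ 5 * 2000 + 1000) s fun s' =>
      (∀ t, t ≠ .tQuot → t ≠ .pre → s'.σ t = s.σ t) ∧ QuotPartial K (K ^ 2) 0 (s'.σ .tQuot) := by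
  have h25 : K ^ 2 ≤ K ^ 5 := Nat.pow_le_pow_right (by omega) (by norm_num)
  have h35 : K ^ 3 ≤ K ^ 5 := Nat.pow_le_pow_right (by omega) (by norm_num)
  have e5 : K ^ 2 * K ^ 3 = K ^ 5 := by ring
  refine (Runs.forLoop (T := 180 + (K ^ 3 * (600 + 130) + 130)) hN hI (fun k s' => Powers K s' ∧
    Frame [.tQuot, .pre] s s' ∧ QuotPartial K k 0 (s'.σ .tQuot))
    (by dsimp only; omega) (by simp) (by simp) ?_ ?_ ?_ (h25.trans (by omega)) ?_).mono ?_ ?_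
  · exact fun k s hs => hs.1.pow2
  · rintro k s u w ⟨h1, h2, h3⟩
    exact ⟨(h1.set (by omega)).set (by omega), (h2.set (by decide)).set (by decide),
      by simpa using h3⟩
  · exact ⟨hs, .refl, fun u hu => by simp at hu⟩
  · rintro k hk s₁ ⟨h1, h2, h3⟩ hi
    change s₁.σ .pre 10 = k at hi
    refine (wp.runs (Q := fun s' => Powers K s' ∧ Frame [.tQuot, .pre] s s' ∧
      QuotPartial K k 0 (s'.σ .tQuot) ∧ s'.σ .pre 10 = k ∧ s'.σ .pre 9 = K ^ 2 * 0 + k ∧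
      s'.σ .pre 13 = 0 / (k + 1) ∧ s'.σ .pre 14 = 0 % (k + 1)) hN hI
      (by simp only [Cmd.bound]; omega) ?_).seq ?_
    · simp only [wp, hi, add_zero]
      refine ⟨by omega, ((h1.set (by omega)).set (by omega)).set (by omega),
        ((h2.set (by decide)).set (by decide)).set (by decide), by simpa using h3, ?_, ?_, ?_, ?_⟩
        <;> simp [hi]
    · intro s₂ hs₂
      refine (Runs.forLoop hN hI (fun j s' => Powers K s' ∧ Frame [.tQuot, .pre] s s' ∧
        QuotPartial K k j (s'.σ .tQuot) ∧ s'.σ .pre 10 = k ∧ s'.σ .pre 9 = K ^ 2 * j + k ∧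
        s'.σ .pre 13 = j / (k + 1) ∧ s'.σ .pre 14 = j % (k + 1))
        (by dsimp only; omega) (by simp) (by simp) ?_ ?_ hs₂ (h35.trans (by omega)) ?_).mono le_rfl
        ?_
      · exact fun j s hs => hs.1.pow3
      · rintro j s u w ⟨h1, h2, h3, h4, h5, h6, h7⟩
        exact ⟨(h1.set (by omega)).set (by omega), (h2.set (by decide)).set (by decide),
          by simpa using h3, by simpa using h4, by simpa using h5, by simpa using h6,
          by simpa using h7⟩
      · rintro j hj s₃ ⟨h1, h2, h3, h4, h5, h6, h7⟩ hi₃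
        change s₃.σ .pre 11 = j at hi₃
        refine wp.runs_le hN hI (by simp [Cmd.bound]; omega) (by simp [Cmd.cost]) ?_
        have hlt : K ^ 2 * j + K ^ 2 ≤ K ^ 5 := by
          rw [← e5, ← Nat.mul_succ]; exact Nat.mul_le_mul_left _ hj
        have hq : j / (k + 1) ≤ j := Nat.div_le_self _ _
        have hm : j % (k + 1) ≤ j := Nat.mod_le _ _
        have hsucc := succ_div_mod j k
        have hup := h3.update hk rfl
        simp [wp, h1.pow2, h4, h5, h6, h7, hi₃]
        have e1 : K ^ 2 * (j + 1) = K ^ 2 * j + K ^ 2 := by ring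
        have hfr : ∀ s' : St, (∀ t, t ≠ .tQuot → t ≠ .pre → s'.σ t = s₃.σ t) → s'.out = s₃.out →
            Frame [.tQuot, .pre] s s' := fun s' h h' => h2.trans ⟨fun t ht => by
          simp only [List.mem_cons, List.not_mem_nil, or_false, not_or] at ht
          exact h t ht.1 ht.2, h'⟩
        refine ⟨by omega, by omega, by omega, fun he => ?_, fun he => ?_⟩
        · rw [if_pos (by omega)] at hsucc
          refine ⟨by omega, ?_, hfr _ (fun t ht ht' => by simp [ht, ht']) (by simp), hup, by omega,
            hsucc.1.symm, hsucc.2.symm⟩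
          constructor <;> simp [h1.pow1, h1.pow2, h1.pow3, h1.pow4, h1.pow5]
        · rw [if_neg (by omega)] at hsucc
          refine ⟨?_, hfr _ (fun t ht ht' => by simp [ht, ht']) (by simp), hup, by omega,
            hsucc.1.symm, hsucc.2.symm⟩
          constructor <;> simp [h1.pow1, h1.pow2, h1.pow3, h1.pow4, h1.pow5]
      -- A column filled up to row `K ^ 3` is complete, and the next column starts empty.
      · rintro s₃ ⟨h1, h2, h3, h4, -⟩
        refine ⟨h4, h1, h2, fun u hu => h3 u ?_⟩
        rcases hu with ⟨hu, h⟩ | hu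
        · rcases Nat.lt_succ_iff_lt_or_eq.1 hu with h' | h'
          · exact .inl ⟨h', h⟩
          · exact .inr ⟨h', h⟩
        · exact absurd hu.2 (Nat.not_lt_zero _)
  · have h1 : K ^ 2 * (180 + (K ^ 3 * (600 + 130) + 130) + 130) = K ^ 5 * 730 + K ^ 2 * 440 := by
      ring
    omega
  · rintro s' ⟨-, h2, h3⟩
    exact ⟨fun t h h' => h2.1 t (by simp [h, h']), h3⟩

end Precomputation

/-! ### Running time of the query -/

section Cost

variable {D d : ℕ}

theorem cost_copy (t u : Cls) : (copy t u D).cost ≤ D * 60 :=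
  cost_rep fun _ _ => le_rfl

theorem cost_copyShift (t u : Cls) : (copyShift t u D).cost ≤ D * 60 :=
  cost_rep fun k _ => by cases k <;> exact le_rfl

theorem cost_clear (t : Cls) : (clear t D).cost ≤ D * 60 :=
  cost_rep fun _ _ => le_rfl

theorem cost_addmul (X : Cls) (s : ℕ) {n : ℕ} (hn : n ≤ D) :
  (addmul X s n).cost ≤ D * 360 + 60 := by
  have h : (rep (addmulStep X s) n).cost ≤ n * 360 := cost_rep fun _ _ => le_rfl
  simp only [addmul, Cmd.cost]
  omega

theorem cost_trySub (s : ℕ) : (trySub D s).cost ≤ D * 480 + 300 := by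
  have h1 := cost_copy (D := D) .tmp .rem
  have h2 := cost_copy (D := D) .rem .tmp
  have h3 := cost_addmul .compl s (Nat.sub_le D s)
  simp only [trySub, Cmd.cost]
  omega

theorem cost_divStep (m s : ℕ) : (divStep D m s).cost ≤ D * 960 + 1200 := by
  have h := cost_trySub (D := D) s
  simp only [divStep, divEst, Cmd.cost]
  omega

theorem cost_divLead (m : ℕ) : (divLead D m).cost ≤ D * (D * 960 + 1200) :=
  (cost_repDown fun _ _ => cost_divStep _ _).trans (Nat.mul_le_mul_right _ (by omega))

theorem cost_divCases (m : ℕ) : (divCases D m).cost ≤ D * (D * 960 + 1200) + 4 * m := by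
  induction m with
  | zero => simp [divCases, Cmd.cost]
  | succ m ih =>
    have h := cost_divLead (D := D) (m + 1)
    simp only [divCases, Cmd.cost]
    omega

theorem cost_divMod : (divMod D).cost ≤ D * (D * 960 + 1400) := by
  have h1 := cost_clear (D := D) .quo
  have h2 : (rep (fun i => .look (.compl, i) .tCompl (.dvs, i)) D).cost ≤ D * 60 :=
    cost_rep fun _ _ => le_rfl
  have h3 := cost_divCases (D := D) (D - 1)
  simp only [divMod, Cmd.cost]
  rw [show D * (D * 960 + 1400) = D * (D * 960 + 1200) + D * 200 by ring]
  omega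

theorem cost_readNum (o : ℕ) : (readNum D d o).cost ≤ D * 60 + d * (D * 1920 + 1600) := by
  have h1 (t : Cls) := cost_clear (D := D) t
  have h2 := cost_copy (D := D) .acc .tmp
  have h3 : (toDigits .tmp).cost ≤ 5 * 120 := cost_rep fun _ _ => le_rfl
  have h4 : (mulBase D).cost ≤ 5 * (D * 360 + 180) := cost_rep fun j _ => by
    have := cost_addmul .acc j (Nat.sub_le D j)
    simp only [Cmd.cost]
    omega
  refine Nat.add_le_add (h1 .acc) (cost_repDown fun i _ => ?_)
  have := h1 .tmp
  simp only [Cmd.cost]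
  omega

theorem cost_outNum : (outNum D d).cost ≤ d * (D * (D * 960 + 1400) + D * 60 + 720) :=
  cost_rep fun _ _ => by
    have h1 := cost_divMod (D := D)
    have h2 := cost_copyShift (D := D) .rem .quo
    have h3 : outDigit.cost = 720 := rfl
    simp only [Cmd.cost]
    omega

/-- The dominant part is the output: `2 * d` divisions, each quadratic in `D`. This is cubic in `d`,
so the fourth power and the constant are generous. -/
theorem cost_divide (hd : 1 ≤ d) (hD : D ≤ 15 * d) : (divide D d).cost ≤ 3000000 * d ^ 4 := by
  have h1 := cost_readNum (D := D) (d := d) 0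
  have h2 := cost_readNum (D := D) (d := d) d
  have h3 := cost_outNum (D := D) (d := d)
  have h4 := cost_divMod (D := D)
  have h5 (t u : Cls) := cost_copyShift (D := D) t u
  have h6 (t u : Cls) := cost_copy (D := D) t u
  have h7 : (toDigits .base).cost ≤ 5 * 120 := cost_rep fun _ _ => le_rfl
  have h8 : (loadBase D).cost ≤ D * 60 := cost_rep fun i _ => by
    split_ifs <;> exact le_rfl
  have i1 := h5 .rem .acc
  have i2 := h5 .dvs .acc
  have i3 := h5 .rem .quo
  have i4 := h6 .sav .rem
  have i5 := h6 .rem .sav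
  have p1 : D * (D * 960 + 1400) ≤ 15 * d * (15 * d * 960 + 1400) := by gcongr
  have p2 : d * (D * 1920 + 1600) ≤ d * (15 * d * 1920 + 1600) := by gcongr
  have p3 : d * (D * (D * 960 + 1400) + D * 60 + 720) ≤
      d * (15 * d * (15 * d * 960 + 1400) + 15 * d * 60 + 720) := by gcongr
  have q1 : d ≤ d ^ 4 := Nat.le_self_pow (by norm_num) d
  have q2 : d ^ 2 ≤ d ^ 4 := Nat.pow_le_pow_right hd (by norm_num)
  have q3 : d ^ 3 ≤ d ^ 4 := Nat.pow_le_pow_right hd (by norm_num)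
  have r1 : 15 * d * (15 * d * 960 + 1400) = 216000 * d ^ 2 + 21000 * d := by ring
  have r2 : d * (15 * d * 1920 + 1600) = 28800 * d ^ 2 + 1600 * d := by ring
  have r3 : d * (15 * d * (15 * d * 960 + 1400) + 15 * d * 60 + 720) =
      216000 * d ^ 3 + 21900 * d ^ 2 + 720 * d := by ring
  simp only [divide, Cmd.cost]
  omega

end Cost

/-! ### Assembling the two phases -/

/-- The pre-computation of the look-up tables. -/
def preparation : Cmd := findBase ;; fillDigits ;; fillQuot

theorem Tables.of_partial {K : ℕ} {s s' : St} (hK : 2 ≤ K) (h : Partial K (K ^ 5) (K ^ 4) K s)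
    (hs : ∀ t, t ≠ .tQuot → t ≠ .pre → s'.σ t = s.σ t)
    (hq : QuotPartial K (K ^ 2) 0 (s'.σ .tQuot)) : Tables K s'.σ := by
  constructor
  · rw [hs _ (by decide) (by decide)]; exact h.div
  · rw [hs _ (by decide) (by decide)]; exact h.mod
  · rw [hs _ (by decide) (by decide)]; exact h.mul
  · intro v hv
    refine hq v (.inl ⟨Nat.mod_lt _ (by positivity), Nat.div_lt_of_lt_mul ?_⟩)
    rwa [← pow_add]
  · rw [hs _ (by decide) (by decide)]; exact h.shift
  · intro u hu
    rw [hs _ (by decide) (by decide)]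
    have : K < K ^ 4 := by
      calc K = K ^ 1 := (pow_one K).symm
        _ < K ^ 4 := Nat.pow_lt_pow_right (by omega) (by norm_num)
    exact h.compl u hu (.inl (by omega))

section Main

variable {V N : ℕ} {I : ℕ → ℕ}

theorem runs_preparation (hI : ∀ j, I j ≤ V) (hN0 : 1 ≤ N) (hV : 1000 + 64 * N ≤ V) (s : St) :
    Runs V N I preparation (133000 * N) s fun s' =>
      ∃ K, 2 ≤ K ∧ N < K ^ 5 ∧ 2 * K ^ 5 ≤ V ∧ Tables K s'.σ := by
  have hN : N ≤ V := by omega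
  -- Each of the two filling phases takes at most `2000 * K ^ 5 + 1000` steps, and `K ^ 5 ≤ 32 * N`.
  refine (Runs.seq (T₂ := 128000 * N + 2000) (runs_findBase hN hI hN0 (by omega) s) ?_).mono
    (by omega) fun _ => id
  rintro s₁ ⟨K, hK, hNK, hKN, hP⟩
  refine (Runs.seq (runs_fillDigits hN hI hK (by omega) hP) fun s₂ h₂ =>
    (runs_fillQuot hN hI hK (by omega) h₂.powers).mono le_rfl fun s₃ h₃ => ?_).mono
    (by omega) fun _ => id
  exact ⟨K, hK, hNK, by omega, .of_partial hK h₂ h₃.1 h₃.2⟩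

theorem Runs.haltsIn {c : Cmd} {T M : ℕ} {s : St} {Q : St → Prop} {m : ℕ → ℕ}
    (h : Runs V N I c T s Q) (hM : 32 * V + 32 ≤ M) (hr : Rep V (Config.start m) s) :
    ∃ g, HaltsIn (c.compile 0) N I M T (Config.start m) g ∧ ∃ s', Rep V g s' ∧ Q s' := by
  obtain ⟨t, ht, ⟨hpc, hQ⟩, hb⟩ := h (c.compile 0) (Config.start m) ⟨[], [], by simp [Config.start],
    rfl⟩ hr
  refine ⟨_, ⟨t, ht, rfl, ?_, fun k hk => ?_⟩, hQ⟩
  · rw [IsFinal, hpc, Cmd.length_compile]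
    exact Nat.le_add_left _ _
  · obtain ⟨h1, h2, h3⟩ := hb k hk
    exact ⟨h1.trans hM, h2.trans hM, fun j => (h3 j).trans hM⟩

theorem pairInput_le {d a b : ℕ} (hN : 1 ≤ N) (j : ℕ) : pairInput N d a b j ≤ N := by
  have h : ∀ x ∈ digitList N d a ++ digitList N d b, x ≤ N := by
    intro x hx
    simp only [digitList, List.mem_append, List.mem_map] at hx
    rcases hx with ⟨i, -, rfl⟩ | ⟨i, -, rfl⟩ <;> exact (Nat.mod_lt _ hN).le
  rw [pairInput, List.getD_eq_getElem?_getD]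
  cases hj : (digitList N d a ++ digitList N d b)[j]? with
  | none => simp
  | some x => exact h x (List.mem_of_getElem? hj)

theorem pairInput_left {d a b i : ℕ} (hi : i < d) : pairInput N d a b i = a / N ^ i % N := by
  simp [pairInput, digitList, List.getElem?_append, hi]

theorem pairInput_right {d a b i : ℕ} (hi : i < d) :
    pairInput N d a b (d + i) = b / N ^ i % N := by
  simp [pairInput, digitList, hi]

end Main

end AddRAM

theorem mainTheorem1 :
    ∃ C : ℕ, ∀ d : ℕ, 1 ≤ d →
      ∃ (M : AddRAM.TwoPhaseRAM) (c : ℕ), ∀ N : ℕ, 1 ≤ N →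
        ∃ c₁ : AddRAM.Config,
          -- pre-computation from the input `N` alone, on zero-initialized memory, in time `O(N)`
          AddRAM.HaltsIn M.pre N (fun _ => 0) (c * N) (c * N)
            (AddRAM.Config.start fun _ => 0) c₁ ∧
          -- division of any two integers, on the pre-computed memory, in time `O(d ^ 4)`
          ∀ a b : ℕ, a < N ^ d → b < N ^ d → 0 < b →
            ∃ c₂ : AddRAM.Config,
              AddRAM.HaltsIn M.query N (AddRAM.pairInput N d a b) (c * N) (C * d ^ 4)
                (AddRAM.Config.start c₁.mem) c₂ ∧
              c₂.out = AddRAM.digitList N d (a / b) ++ AddRAM.digitList N d (a % b) := by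
  open AddRAM in
  refine ⟨3000000, fun d hd => ⟨⟨preparation.compile 0, (divide (5 * d + 10) d).compile 0⟩,
    32 * (1064 + (divide (5 * d + 10) d).bound) + 133032, fun N hN => ?_⟩⟩
  -- The same `V` serves both phases, so the memory left by the pre-computation represents an
  -- admissible start of the query. It leaves room for the tables (`1000 + 64 * N`) and for the
  -- constants and cell indices of the query. The summand `133032` in `c` covers the `133000 * N`
  -- steps and the `32` in `32 * V + 32`.
  obtain ⟨V, hV⟩ : ∃ V, V = (1064 + (divide (5 * d + 10) d).bound) * N := ⟨_, rfl⟩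
  have hB := Nat.le_mul_of_pos_right (divide (5 * d + 10) d).bound hN
  have hVN : 1000 + 64 * N + (divide (5 * d + 10) d).bound ≤ V := by
    rw [hV, add_mul]
    omega
  have hM : (32 * (1064 + (divide (5 * d + 10) d).bound) + 133032) * N = 32 * V + 133032 * N := by
    rw [hV]; ring
  rw [hM]
  obtain ⟨c₁, h₁, s₁, hr₁, K, hK, hNK, hKV, hT⟩ := Runs.haltsIn (M := 32 * V + 133032 * N)
    (runs_preparation (V := V) (I := fun _ => 0) (fun _ => Nat.zero_le _) hN (by omega)
      ⟨fun _ _ => 0, []⟩) (by omega) (m := fun _ => 0)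
    ⟨⟨Nat.zero_le _, Nat.zero_le _, fun _ => Nat.zero_le _⟩, rfl, fun _ _ => rfl,
      fun _ _ => Nat.zero_le _⟩
  refine ⟨c₁, ?_, fun a b ha hb hb0 => ?_⟩
  · obtain ⟨t, ht, h⟩ := h₁
    exact ⟨t, by omega, h⟩
  · obtain ⟨c₂, h₂, s₂, hr₂, ho⟩ := Runs.haltsIn (M := 32 * V + 133032 * N)
      ((wp.runs (V := V) (N := N) (I := pairInput N d a b) (by omega)
        (fun j => (pairInput_le hN j).trans (by omega)) (by omega)
        (wp_divide (st := ⟨s₁.σ, []⟩) hK hKV hNK hN hT rfl ha hb hb0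
          (fun i hi => pairInput_left hi) fun i hi => pairInput_right hi)).mono
        (cost_divide hd (by omega)) fun _ => id) (by omega) (m := c₁.mem)
      ⟨⟨Nat.zero_le _, Nat.zero_le _, hr₁.bounded.2.2⟩, rfl, hr₁.mem_eq, hr₁.le⟩
    exact ⟨c₂, h₂, by rw [hr₂.out_eq, ho]; rfl⟩
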